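/- Consider the following slotted proactive caching problem. Contents are represented by their remaining lifetimes (positive integers), and sets of contents are multisets. The state at time $t$ is $S_t=(\mathcal O_t,\mathcal I_t,E_t)$, where $\mathcal I_t$ is the content of a cache of capacity $B$ (so $|\mathcal I_t|\le B$), $\mathcal O_t$ is the multiset of relevant contents outside the cache, and $E_t\ge 0$ is the time elapsed since the last user access; the user accesses at time $t$ iff $E_t=0$. An action is a pair $A_t=(A^{(1)}_t,A^{(2)}_t)$ with $A_t^{(1)}\subseteq\mathcal O_t$ (downloaded) and $A_t^{(2)}\subseteq\mathcal I_t$ (discarded). If $E_t=0$, the only available action is $(\mathcal O_t,\mathcal I_t)$, and $\mathcal I_{t+1}=\emptyset$, $\mathcal O_{t+1}=\mathcal N_{t+1}$. If $E_t>0$, every action with $|(\mathcal I_t\cup A^{(1)}_t)\setminus A^{(2)}_t|\le B$ is available, and $$\mathcal I_{t+1}=\big((\mathcal I_t\cup A^{(1)}_t)\setminus A^{(2)}_t\big)-1,\qquad \mathcal O_{t+1}=\Big(\big((\mathcal O_t\cup A^{(2)}_t)\setminus A^{(1)}_t\big)-1\Big)\cup\mathcal N_{t+1},$$ where $Z-1$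 reduces every lifetime by one and removes the expired contents. The newly generated contents $\mathcal N_{t+1}$ consist of $M\le M_{\max}$ contents with i.i.d. lifetimes distributed as $K\in\{1,\dots,K_{\max}\}$, i.i.d. over time. The user accesses form an arrival process with i.i.d. inter-arrival times $D$, either with $1\le D\le D_{\max}$, or geometric with parameter $p_a>0$; in the geometric case $E_t$ is replaced by the indicator of $E_t>0$. The channel costs $C_t$ are i.i.d. continuous random variables in $(0,C_{\max}]$; $C_t$ is observed before $A_t$ is chosen, and the cost of slot $t$ is $C_t\,|A^{(1)}_t|$. Costs, user accesses, and numbers and lifetimes of new contents are independent. $\mathcal S$ is the finite set of states: $E$ is a possible value of the elapsed time (or of its indicator), $|\mathcal I|\le B$, lifetimes lie in $\{1,\dots,K_{\max}\}$, and for every $k\le K_{\max}$ at most $M_{\max}(K_{\max}+1-k)$ contents of $\mathcal O\cup\mathcal I$ have remaining lifetime at least $k$. A deterministic policy chooses an available action for each pair (state, channel cost), measurably in the channel cost; it is optimal if, from every initial state in $\mathcal S$, it minimizes the long-term expected average cost $\limsup_{T\to\infty}\mathbb E\big[\frac1T\sum_{t=1}^T C_t|A^{(1)}_t|\big]$ among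 all causal, possibly history-dependent and randomized, control strategies. For a state $s=(\mathcal O,\mathcal I,E)$ let $l_1\le\dots\le l_B$ be the elements of $\mathcal I$ and $L_1\ge\dots\ge L_B$ the $B$ largest elements of $\mathcal O$, both padded with zeros if there are fewer than $B$ of them. For $E>0$, the simple action $(l_i|L_i)$ discards $l_i$ from the cache (unless $l_i=0$) and downloads $L_i$ into the cache (unless $L_i=0$). **Theorem.** There are a deterministic optimal policy and, for every state $s=(\mathcal O,\mathcal I,E)\in\mathcal S$ with $E>0$ (the user does not access), thresholds $$0\le\mathcal T_B\le\mathcal T_{B-1}\le\dots\le\mathcal T_1\le C_{\max},$$ depending on $s$, such that in state $s$ and for channel cost $C\in(0,C_{\max}]$ the policy performs exactly those simple actions $(l_i|L_i)$, $1\le i\le B$, for which $C\le\mathcal T_i$. -/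

import Mathlib

open MeasureTheory ProbabilityTheory Filter
open scoped ENNReal

noncomputable section

namespace ProactiveCaching

/-! ### States and actions -/

/-- A state: the remaining lifetimes of the relevant contents outside the cache, those of the
contents in the cache, and the time elapsed since the last user access.  The user accesses the
system in the current slot iff `elapsed = 0`. -/
@[ext]
structure State where
  out : Multiset ℕ
  cache : Multiset ℕ
  elapsed : ℕ

/-- An action: the contents that are downloaded (a sub-multiset of `State.out`) and the cached
contents that are discarded (a sub-multiset of `State.cache`). -/
@[ext]
structure Action where
  download : Multiset ℕ
  discard : Multiset ℕ

instance : Countable State :=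
  Function.Injective.countable (f := fun s : State => (s.out, s.cache, s.elapsed))
    (fun s t h => by simpa [State.ext_iff] using h)

instance : Countable Action :=
  Function.Injective.countable (f := fun a : Action => (a.download, a.discard))
    (fun a b h => by simpa [Action.ext_iff] using h)

instance : MeasurableSpace State := ⊤
instance : MeasurableSpace Action := ⊤
instance : DiscreteMeasurableSpace State := ⟨fun _ => trivial⟩
instance : DiscreteMeasurableSpace Action := ⟨fun _ => trivial⟩

/-- The multiset `Z - 1`: all lifetimes are reduced by one, expired contents are removed. -/
def age (Z : Multiset ℕ) : Multiset ℕ := (Z.filter (1 < ·)).map (· - 1)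

/-- The contents of the next state, given the current state and action, the newly generated
contents `N`, and the next value `e` of the user state. -/
def nextState (s : State) (a : Action) (N : Multiset ℕ) (e : ℕ) : State :=
  if s.elapsed = 0 then ⟨N, 0, e⟩
  else ⟨age (s.out + a.discard - a.download) + N, age (s.cache + a.download - a.discard), e⟩

/-! ### The two user access models -/

/-- The user access process: either i.i.d. inter-arrival times with law `D` on the positive
integers, bounded by `Dmax`, or geometric inter-arrival times, that is, the access indicators
are i.i.d. with law `U` and `U true` is the access probability. -/
inductive AccessModel where
  | bounded (D : PMF ℕ) (Dmax : ℕ) (hD : ∀ d ∈ D.support, 1 ≤ d ∧ d ≤ Dmax) : AccessModel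
  | geometric (U : PMF Bool) (hU : 0 < U true) : AccessModel

/-- The possible user states.  For bounded inter-arrival times these are the values `e` of the
elapsed time with `P(D > e) > 0`; in the geometric case only the indicator (`0` or `1`) of the
event that the elapsed time is positive is recorded. -/
def AccessModel.Possible : AccessModel → ℕ → Prop
  | .bounded D _ _, e => ∃ d ∈ {d | e < d}, d ∈ D.support
  | .geometric _ _, e => e ≤ 1

open Classical in
/-- The law of the next user state.  For bounded inter-arrival times, given that the current
inter-arrival time `D` exceeds `e`, the user accesses in the next slot iff `D = e + 1`.
(The value `pure 0` at impossible user states is irrelevant.) -/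
def AccessModel.next : AccessModel → ℕ → PMF ℕ
  | .bounded D _ _, e =>
      if h : ∃ d ∈ {d | e < d}, d ∈ D.support then
        (D.filter {d | e < d} h).map (fun d => if d = e + 1 then 0 else e + 1)
      else PMF.pure 0
  | .geometric U _, _ => U.map (fun u => if u then 0 else 1)

/-! ### The model -/

/-- The law of the multiset of `m` independent draws from `K`. -/
def iidMultiset (K : PMF ℕ) : ℕ → PMF (Multiset ℕ)
  | 0 => PMF.pure 0
  | m + 1 => K.bind fun k => (iidMultiset K m).map fun Z => k ::ₘ Z

/-- The data of the proactive caching problem. -/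
structure Model where
  /-- the cache capacity -/
  B : ℕ
  /-- the law of the number of contents generated in a slot -/
  M : PMF ℕ
  Mmax : ℕ
  M_le : ∀ k ∈ M.support, k ≤ Mmax
  /-- the law of the lifetime of a new content -/
  K : PMF ℕ
  Kmax : ℕ
  K_mem : ∀ k ∈ K.support, 1 ≤ k ∧ k ≤ Kmax
  /-- the law of the channel cost, a continuous random variable in `(0, Cmax]` -/
  C : Measure ℝ
  Cmax : ℝ
  [C_prob : IsProbabilityMeasure C]
  C_mem : ∀ᵐ c ∂C, 0 < c ∧ c ≤ Cmax
  C_cont : ∀ c, C {c} = 0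
  /-- the user access model -/
  access : AccessModel

attribute [instance] Model.C_prob

namespace Model

variable (m : Model)

/-- The law of the multiset of lifetimes of the contents generated in a slot. -/
def newContents : PMF (Multiset ℕ) := m.M.bind (iidMultiset m.K)

/-- The (finite) state space.  As at most `Mmax` contents are generated per slot, with lifetimes
at most `Kmax`, there are never more than `Mmax * (Kmax + 1 - k)` contents with remaining
lifetime at least `k`. -/
structure IsState (s : State) : Prop where
  lifetime : ∀ z ∈ s.out + s.cache, 1 ≤ z ∧ z ≤ m.Kmax
  count : ∀ k, (s.out + s.cache).countP (k ≤ ·) ≤ m.Mmax * (m.Kmax + 1 - k)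
  capacity : s.cache.card ≤ m.B
  possible : m.access.Possible s.elapsed

/-- The actions available in a state.  When the user accesses, everything outside the cache is
downloaded and everything is moved out of the cache. -/
def Feasible (s : State) (a : Action) : Prop :=
  if s.elapsed = 0 then a.download = s.out ∧ a.discard = s.cache
  else a.download ≤ s.out ∧ a.discard ≤ s.cache ∧
    (s.cache + a.download - a.discard).card ≤ m.B

/-- The law of the next state: new contents and user access are independent. -/
def nextLaw (s : State) (a : Action) : PMF State :=
  m.newContents.bind fun N => (m.access.next s.elapsed).map fun e => nextState s a N e

/-- The transition kernel. -/
def transition : Kernel (State × Action) State :=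
  Kernel.ofFunOfCountable fun p => (m.nextLaw p.1 p.2).toMeasure

instance : IsMarkovKernel m.transition :=
  ⟨fun p => inferInstanceAs (IsProbabilityMeasure (m.nextLaw p.1 p.2).toMeasure)⟩

end Model

/-! ### Strategies, and the controlled chain -/

/-- What happens in one slot: the state, the channel cost, the action. -/
abbrev Slot : Type := (State × ℝ) × Action

/-- The cost incurred in a slot. -/
def slotCost (x : Slot) : ℝ≥0∞ := x.2.download.card * ENNReal.ofReal x.1.2

/-- A causal, possibly randomized control strategy: the (law of the) action of slot `n` may
depend on everything that happened in the slots before, and on the current state and channel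
cost; only feasible actions are taken. -/
structure Strategy (m : Model) where
  act : (n : ℕ) → Kernel ((Fin n → Slot) × (State × ℝ)) Action
  markov : ∀ n, IsMarkovKernel (act n)
  feasible : ∀ n h s c, ∀ᵐ a ∂(act n (h, (s, c))), m.Feasible s a

/-- A deterministic policy: a feasible action for every state and channel cost, measurable in
the channel cost. -/
structure Policy (m : Model) where
  act : State → ℝ → Action
  measurable : ∀ s, Measurable (act s)
  feasible : ∀ s c, m.Feasible s (act s c)

namespace Strategy

variable {m : Model} (σ : Strategy m)

instance (n : ℕ) : IsMarkovKernel (σ.act n) := σ.markov n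

/-- A history up to slot `n`, as a tuple. -/
def toTuple (n : ℕ) (h : Finset.Iic n → Slot) (i : Fin (n + 1)) : Slot :=
  h ⟨i, Finset.mem_Iic.2 (Nat.lt_succ_iff.1 i.2)⟩

lemma measurable_toTuple (n : ℕ) : Measurable (toTuple n) :=
  measurable_pi_lambda _ fun _ => measurable_pi_apply _

/-- The state and action of the last slot of a history. -/
def last (n : ℕ) (h : Finset.Iic n → Slot) : State × Action :=
  ((h ⟨n, Finset.mem_Iic.2 le_rfl⟩).1.1, (h ⟨n, Finset.mem_Iic.2 le_rfl⟩).2)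

lemma measurable_last (n : ℕ) : Measurable (last n) := by
  have h : Measurable fun h : Finset.Iic n → Slot => h ⟨n, Finset.mem_Iic.2 le_rfl⟩ :=
    measurable_pi_apply _
  exact (measurable_fst.comp (measurable_fst.comp h)).prodMk (measurable_snd.comp h)

lemma measurable_view (n : ℕ) :
    Measurable fun p : (Finset.Iic n → Slot) × (State × ℝ) => (toTuple n p.1, p.2) :=
  ((measurable_toTuple n).comp measurable_fst).prodMk measurable_snd

/-- The law of slot `n + 1` given the slots `0, …, n`: the next state is drawn from the
transition kernel, the channel cost independently from its law, the action by the strategy. -/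
def step (n : ℕ) : Kernel (Finset.Iic n → Slot) Slot :=
  (m.transition.comap (last n) (measurable_last n) ×ₖ Kernel.const _ m.C) ⊗ₖ
    (σ.act (n + 1)).comap _ (measurable_view n)

instance (n : ℕ) : IsMarkovKernel (σ.step n) := by
  unfold step; infer_instance

/-- The law of the first slot, if the initial state is `s`. -/
def initial (s : State) : Measure Slot :=
  ((Measure.dirac s).prod m.C) ⊗ₘ
    (σ.act 0).comap (fun p : State × ℝ => ((Fin.elim0 : Fin 0 → Slot), p))
      (measurable_const.prodMk measurable_id)

/-- The law of the controlled chain with initial state `s`. -/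
def law (s : State) : Measure (ℕ → Slot) :=
  Kernel.trajMeasure (X := fun _ => Slot) (σ.initial s) σ.step

/-- The long-term expected average cost, starting from `s`. -/
def averageCost (s : State) : ℝ≥0∞ :=
  limsup (fun T : ℕ => (∫⁻ ω, ∑ t ∈ Finset.range T, slotCost (ω t) ∂(σ.law s)) / T) atTop

end Strategy

namespace Policy

variable {m : Model} (π : Policy m)

lemma measurable_act :
    ∀ n : ℕ, Measurable fun p : (Fin n → Slot) × (State × ℝ) => π.act p.2.1 p.2.2 := by
  intro n
  have h : Measurable fun p : State × ℝ => π.act p.1 p.2 :=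
    measurable_from_prod_countable_right fun s => π.measurable s
  exact h.comp measurable_snd

/-- A deterministic policy as a strategy. -/
def toStrategy : Strategy m where
  act n := Kernel.deterministic _ (π.measurable_act n)
  markov _ := inferInstance
  feasible n h s c := by
    rw [Kernel.deterministic_apply, ae_dirac_eq]
    exact π.feasible s c

/-- A deterministic policy is optimal if, from every initial state, it minimizes the long-term
expected average cost among all causal, possibly randomized strategies. -/
def IsOptimal : Prop :=
  ∀ s, m.IsState s → ∀ σ : Strategy m, π.toStrategy.averageCost s ≤ σ.averageCost s

end Policy

/-! ### Swaps -/

/-- The contents `l_1 ≤ ⋯ ≤ l_B` of the cache, in increasing order, where free places count as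
contents of remaining lifetime `0` (indices start at `0`). -/
def cached (m : Model) (s : State) (i : Fin m.B) : ℕ :=
  ((s.cache + Multiset.replicate (m.B - s.cache.card) 0).sort (· ≤ ·)).getD i 0

/-- The `B` largest elements `L_1 ≥ ⋯ ≥ L_B` outside the cache, where missing ones count as `0`
(indices start at `0`). -/
def outside (m : Model) (s : State) (i : Fin m.B) : ℕ :=
  (s.out.sort (· ≥ ·)).getD i 0

/-- The action that performs exactly the swaps `(l_i | L_i)` with `i ∈ J`: `L_i` is downloaded
unless `L_i = 0`, and `l_i` is discarded unless `l_i = 0`. -/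
def swaps (m : Model) (s : State) (J : Finset (Fin m.B)) : Action where
  download := (J.val.map (outside m s)).filter (0 < ·)
  discard := (J.val.map (cached m s)).filter (0 < ·)

end ProactiveCaching

end

/-!
The set `X` of all relevant contents evolves independently of the actions, which only decide which
part of it is cached. A cached set is encoded by its rank function `n`, where `n k` is the number
of cached contents that are still relevant after `k` more slots. Ageing is the shift of `n`, the
cost at an access depends on `n 0` only, and an action with `a` downloads leads to a rank function
of at most `n + a`, truncated at the bound `min B (rank X)`. The swaps `(l_1|L_1), …, (l_a|L_a)`
attain this upper bound as long as the last one puts a content of larger lifetime into the cache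
(`firstSwaps_spec`). As a larger rank function is never worse, the problem reduces to choosing the
number of downloads: the relaxed Bellman operator (`Model.bellman`) minimizes
`c * a + W ((n + a) ⊓ bound)` over `a`, where `W` is the expected future cost, and where `n` may be
any function.

Both steps, the truncation and the minimization over a shift along the all-ones vector, preserve
the class of antitone L♮-convex functions (`LNatural.trunc`, `LNatural.inf_shift`). So do
expectations, whereas M♮-convexity of the value as a function of the cached set, the notion behind
exchange arguments, is not preserved by sums. An L♮-convex function is convex along the all-ones
vector, so the benefits `W ((n + i) ⊓ bound) - W ((n + i + 1) ⊓ bound)` of the successive swaps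
decrease in `i` (`LNatural.convex_fillTo`). Clipped to `[0, Cmax]` they are the thresholds.

For the average cost, the chain regenerates after each access: the next state has a law that does
not depend on the past. So the optimality equation is that of the total cost until the next access,
with `g` subtracted from the cost of every slot. Accesses occur uniformly often, hence the operator
is a contraction in a weighted supremum norm (`AccessModel.exists_weight`,
`Model.exists_fixedPoint`), its fixed point inherits the L♮-convexity from the iterates of zero,
and by the intermediate value theorem the mean of the fixed point after an access vanishes for some
`g ≥ 0` (`Model.exists_isSolution`). Adding up the optimality equation along the controlled chain
shows that every strategy has average cost at least `g` (`Strategy.le_sum_expectedCost`), with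
equality for the threshold policy (`sum_expectedCost_thresholdPolicy_le`).
-/

noncomputable section

namespace ProactiveCaching

/-! ### Rank functions of multisets of lifetimes -/

/-- The rank function of a multiset of lifetimes: `rank Z k` is the number of contents that are
still relevant after `k` further slots, that is, whose remaining lifetime exceeds `k`. -/
def rank (Z : Multiset ℕ) (k : ℕ) : ℕ := Z.countP (k < ·)

lemma rank_add (Y Z : Multiset ℕ) (k : ℕ) : rank (Y + Z) k = rank Y k + rank Z k :=
  Multiset.countP_add _ _ _

lemma rank_le_card (Z : Multiset ℕ) (k : ℕ) : rank Z k ≤ Z.card := Multiset.countP_le_card _ _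

lemma rank_mono {Y Z : Multiset ℕ} (h : Y ≤ Z) (k : ℕ) : rank Y k ≤ rank Z k :=
  Multiset.countP_le_of_le _ h

lemma rank_anti (Z : Multiset ℕ) {k l : ℕ} (h : k ≤ l) : rank Z l ≤ rank Z k := by
  unfold rank
  rw [Multiset.countP_eq_card_filter, Multiset.countP_eq_card_filter]
  exact Multiset.card_le_card (Multiset.monotone_filter_right _ fun a ha => h.trans_lt ha)

lemma rank_zero_eq_card {Z : Multiset ℕ} (h : ∀ z ∈ Z, 1 ≤ z) : rank Z 0 = Z.card :=
  Multiset.countP_eq_card.2 fun z hz => h z hz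

lemma age_add (Y Z : Multiset ℕ) : age (Y + Z) = age Y + age Z := by
  simp [age]

lemma age_mem {Z : Multiset ℕ} {x : ℕ} (h : x ∈ age Z) : ∃ z ∈ Z, 1 < z ∧ x = z - 1 := by
  simp only [age, Multiset.mem_map, Multiset.mem_filter] at h
  obtain ⟨z, ⟨hz, h1⟩, rfl⟩ := h
  exact ⟨z, hz, h1, rfl⟩

lemma rank_age (Z : Multiset ℕ) (k : ℕ) : rank (age Z) k = rank Z (k + 1) := by
  unfold rank age
  rw [Multiset.countP_map, ← Multiset.countP_eq_card_filter, Multiset.countP_filter]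
  refine Multiset.countP_congr rfl fun x _ => ?_
  simp only [eq_iff_iff]
  omega

/-- An action moves contents between the cache and the outside, so that the union of the two
does not depend on it. -/
lemma out_add_cache_action {O I A D : Multiset ℕ} (hA : A ≤ O) (hD : D ≤ I) :
    (O + D - A) + (I + A - D) = O + I := by
  ext x
  have h1 := Multiset.le_iff_count.1 hA x
  have h2 := Multiset.le_iff_count.1 hD x
  simp only [Multiset.count_add, Multiset.count_sub]
  omega

lemma rank_action {I A D : Multiset ℕ} (hD : D ≤ I) (k : ℕ) :
    rank (I + A - D) k + rank D k = rank I k + rank A k := by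
  have h : I + A - D + D = I + A :=
    tsub_add_cancel_of_le (hD.trans (Multiset.le_add_right _ _))
  rw [← rank_add, h, rank_add]

/-! ### L-natural-convexity -/

/-- Translation submodularity, which characterizes the L♮-convex functions of integer vectors:
`F ((p - α) ⊔ q) + F (p ⊓ (q + α)) ≤ F p + F q` for every shift `α ≥ 0` along the all-ones
vector.  Truncated subtraction is harmless, as `q` is nonnegative. -/
def LNatural (F : (ℕ → ℕ) → ℝ) : Prop :=
  ∀ (p q : ℕ → ℕ) (α : ℕ),
    F (fun k => max (p k - α) (q k)) + F (fun k => min (p k) (q k + α)) ≤ F p + F q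

/-- The vector `n + a` truncated at the pointwise bound `b`. -/
def fillTo (b n : ℕ → ℕ) (a : ℕ) : ℕ → ℕ := fun k => min (n k + a) (b k)

lemma fillTo_mono {b n n' : ℕ → ℕ} (h : n ≤ n') (a : ℕ) : fillTo b n a ≤ fillTo b n' a :=
  fun k => min_le_min_right _ (Nat.add_le_add_right (h k) _)

/-- For antitone functions, truncation preserves L♮-convexity. -/
lemma LNatural.trunc {F : (ℕ → ℕ) → ℝ} (hF : LNatural F) (hA : Antitone F) (b : ℕ → ℕ) :
    LNatural fun n => F (fun k => min (n k) (b k)) := by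
  intro p q α
  have h := hF (fun k => min (p k) (b k)) (fun k => min (q k) (b k)) α
  have h1 : F (fun k => min (max (p k - α) (q k)) (b k)) ≤
      F (fun k => max (min (p k) (b k) - α) (min (q k) (b k))) :=
    hA fun k => by dsimp only; omega
  have h2 : (fun k => min (min (p k) (q k + α)) (b k)) =
      fun k => min (min (p k) (b k)) (min (q k) (b k) + α) := by
    funext k; omega
  simp only [h2]
  linarith

/-- Along the all-ones vector, an L♮-convex function is convex. -/
lemma LNatural.convex_fillTo {F : (ℕ → ℕ) → ℝ} (hF : LNatural F) (hA : Antitone F)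
    (b n : ℕ → ℕ) (i : ℕ) :
    2 * F (fillTo b n (i + 1)) ≤ F (fillTo b n (i + 2)) + F (fillTo b n i) := by
  have h := (hF.trunc hA b) (fun k => n k + (i + 2)) (fun k => n k + i) 1
  have h1 : (fun k => min (max (n k + (i + 2) - 1) (n k + i)) (b k)) = fillTo b n (i + 1) := by
    funext k; simp only [fillTo]; omega
  have h2 : (fun k => min (min (n k + (i + 2)) (n k + i + 1)) (b k)) = fillTo b n (i + 1) := by
    funext k; simp only [fillTo]; omega
  simp only [h1, h2] at h
  rw [two_mul]
  exact h

lemma inf'_range_exists (B : ℕ) (f : ℕ → ℝ) :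
    ∃ a ≤ B, (Finset.range (B + 1)).inf' Finset.nonempty_range_add_one f = f a := by
  obtain ⟨a, ha, h⟩ := Finset.exists_mem_eq_inf' (s := Finset.range (B + 1))
    Finset.nonempty_range_add_one f
  exact ⟨a, Nat.lt_succ_iff.1 (Finset.mem_range.1 ha), h⟩

lemma inf'_range_le {B a : ℕ} (f : ℕ → ℝ) (ha : a ≤ B) :
    (Finset.range (B + 1)).inf' Finset.nonempty_range_add_one f ≤ f a :=
  Finset.inf'_le _ (Finset.mem_range.2 (Nat.lt_succ_iff.2 ha))

/-- Minimizing over the length of a shift along the all-ones vector, at a linear price, preserves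
L♮-convexity. -/
lemma LNatural.inf_shift {F : (ℕ → ℕ) → ℝ} (hF : LNatural F) (hA : Antitone F) (b : ℕ → ℕ)
    (B : ℕ) (c : ℝ) :
    LNatural fun n => (Finset.range (B + 1)).inf' Finset.nonempty_range_add_one
      fun a => c * a + F (fillTo b n a) := by
  intro p q α
  obtain ⟨i, hi, hpi⟩ := inf'_range_exists B fun a => c * a + F (fillTo b p a)
  obtain ⟨j, hj, hqj⟩ := inf'_range_exists B fun a => c * a + F (fillTo b q a)
  simp only [hpi, hqj]
  have hT := hF.trunc hA b
  set p' : ℕ → ℕ := fun k => max (p k - α) (q k) with hp'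
  set q' : ℕ → ℕ := fun k => min (p k) (q k + α) with hq'
  rcases le_total j (α + i) with hij | hij
  · -- the minimizers are kept, and the shift between the two points becomes `α + i - j`
    have h := hT (fun k => p k + i) (fun k => q k + j) (α + i - j)
    have h1 : (fun k => min (max (p k + i - (α + i - j)) (q k + j)) (b k)) = fillTo b p' j := by
      funext k; simp only [fillTo, hp']; omega
    have h2 : (fun k => min (min (p k + i) (q k + j + (α + i - j))) (b k)) = fillTo b q' i := by
      funext k; simp only [fillTo, hq']; omega
    simp only [h1, h2] at h
    replace h : _ ≤ F (fillTo b p i) + F (fillTo b q j) := h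
    have e1 := inf'_range_le (fun a => c * a + F (fillTo b p' a)) hj
    have e2 := inf'_range_le (fun a => c * a + F (fillTo b q' a)) hi
    linarith
  · -- the two points change roles, and `α` is moved from one shift to the other
    obtain ⟨d, rfl⟩ := Nat.exists_eq_add_of_le hij
    have h := hT (fun k => q k + (α + i + d)) (fun k => p k + i) d
    have h1 : (fun k => min (max (q k + (α + i + d) - d) (p k + i)) (b k)) =
        fillTo b p' (α + i) := by
      funext k; simp only [fillTo, hp']; omega
    have h2 : (fun k => min (min (q k + (α + i + d)) (p k + i + d)) (b k)) =
        fillTo b q' (i + d) := by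
      funext k; simp only [fillTo, hq']; omega
    simp only [h1, h2] at h
    replace h : _ ≤ F (fillTo b q (α + i + d)) + F (fillTo b p i) := h
    have e1 := inf'_range_le (B := B) (fun a => c * a + F (fillTo b p' a))
      (show α + i ≤ B by omega)
    have e2 := inf'_range_le (B := B) (fun a => c * a + F (fillTo b q' a))
      (show i + d ≤ B by omega)
    push_cast at e1 e2 ⊢
    linarith

lemma antitone_inf_shift {F : (ℕ → ℕ) → ℝ} (hA : Antitone F) (b : ℕ → ℕ) (B : ℕ) (c : ℝ) :
    Antitone fun n => (Finset.range (B + 1)).inf' Finset.nonempty_range_add_one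
      fun a => c * a + F (fillTo b n a) := by
  intro n n' h
  obtain ⟨i, hi, hni⟩ := inf'_range_exists B fun a => c * a + F (fillTo b n a)
  simp only [hni]
  exact (inf'_range_le _ hi).trans (by have := hA (fillTo_mono (b := b) h i); linarith)

lemma abs_inf'_sub_inf'_le {B : ℕ} {f g : ℕ → ℝ} {d : ℝ} (h : ∀ a, |f a - g a| ≤ d) :
    |(Finset.range (B + 1)).inf' Finset.nonempty_range_add_one f -
      (Finset.range (B + 1)).inf' Finset.nonempty_range_add_one g| ≤ d := by
  obtain ⟨i, hi, hf⟩ := inf'_range_exists B f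
  obtain ⟨j, hj, hg⟩ := inf'_range_exists B g
  have h1 := inf'_range_le f hj
  have h2 := inf'_range_le g hi
  have h3 := abs_le.1 (h i)
  have h4 := abs_le.1 (h j)
  rw [abs_le]
  constructor <;> linarith

/-! ### The relaxed Bellman operator -/

/-- Multisets of lifetimes are countable, and all sets of them are measurable. -/
instance : MeasurableSpace (Multiset ℕ) := ⊤
instance : DiscreteMeasurableSpace (Multiset ℕ) := ⟨fun _ => trivial⟩

/-- A reduced state: all relevant contents, in the cache or not; the rank function of the cache,
where arbitrary functions are allowed; and the user state. -/
structure Reduced where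
  contents : Multiset ℕ
  fill : ℕ → ℕ
  elapsed : ℕ

/-- The discrete topology, so that bounded functions are bounded continuous functions. -/
instance : TopologicalSpace Reduced := ⊥
instance : DiscreteTopology Reduced := ⟨rfl⟩

/-- Boundedness of a real function of the reduced state. -/
def Bounded (h : Reduced → ℝ) : Prop := ∃ R, ∀ z, |h z| ≤ R

namespace Model

variable (m : Model)

/-- The joint law of the new contents and of the next user state. -/
def arrivals (e : ℕ) : PMF (Multiset ℕ × ℕ) :=
  m.newContents.bind fun N => (m.access.next e).map fun e' => (N, e')

/-- The law `arrivals` as a measure. -/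
def arrivalLaw (e : ℕ) : Measure (Multiset ℕ × ℕ) := (m.arrivals e).toMeasure

instance (e : ℕ) : IsProbabilityMeasure (m.arrivalLaw e) :=
  inferInstanceAs (IsProbabilityMeasure (m.arrivals e).toMeasure)

lemma map_snd_arrivalLaw (e : ℕ) :
    (m.arrivalLaw e).map Prod.snd = (m.access.next e).toMeasure := by
  rw [arrivalLaw, PMF.toMeasure_map Prod.snd _ measurable_snd, arrivals, PMF.map_bind]
  simp only [PMF.map_comp, Function.comp_def, PMF.bind_const]
  exact congrArg PMF.toMeasure (PMF.map_id _)

/-- The mean channel cost. -/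
def meanCost : ℝ := ∫ c, c ∂m.C

lemma integrable_cost : Integrable (fun c : ℝ => c) m.C := by
  refine Integrable.of_bound measurable_id.aestronglyMeasurable m.Cmax ?_
  filter_upwards [m.C_mem] with c hc
  rw [Real.norm_eq_abs, abs_of_pos hc.1]
  exact hc.2

lemma meanCost_nonneg : 0 ≤ m.meanCost :=
  integral_nonneg_of_ae (by filter_upwards [m.C_mem] with c hc using hc.1.le)

lemma Cmax_pos : 0 < m.Cmax := by
  obtain ⟨c, hc⟩ := m.C_mem.exists
  exact hc.1.trans_le hc.2

/-- The expected value of `h` in the next slot, if the cache has rank function `n` after the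
action of a slot in which the user does not access. -/
def continuation (h : Reduced → ℝ) (X : Multiset ℕ) (e : ℕ) (n : ℕ → ℕ) : ℝ :=
  ∫ p, h ⟨age X + p.1, fun k => n (k + 1), p.2⟩ ∂m.arrivalLaw e

/-- The bound on the rank function of the cache: its capacity, and the available contents. -/
def bound (X : Multiset ℕ) : ℕ → ℕ := fun k => min m.B (rank X k)

/-- The value of a slot without access, if the channel cost is `c`: the minimum over the number
of downloads, where `a` downloads raise the rank function of the cache by `a`, up to `bound`. -/
def slotValue (h : Reduced → ℝ) (X : Multiset ℕ) (e : ℕ) (n : ℕ → ℕ) (c : ℝ) : ℝ :=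
  (Finset.range (m.B + 1)).inf' Finset.nonempty_range_add_one
    fun a => c * a + m.continuation h X e (fillTo (m.bound X) n a)

/-- The maximal number of relevant contents. -/
def maxContents : ℕ := m.Mmax * m.Kmax

/-- The relaxed Bellman operator for the cost per slot reduced by `g`, stopped after an access.
The truncation at `maxContents` makes the cost bounded and does not matter in states of the
model. -/
def bellman (g : ℝ) (h : Reduced → ℝ) (z : Reduced) : ℝ :=
  if z.elapsed = 0 then m.meanCost * ((min z.contents.card m.maxContents - z.fill 0 : ℕ) : ℝ) - g
  else ∫ c, m.slotValue h z.contents z.elapsed z.fill c ∂m.C - g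

variable {m} {h h' : Reduced → ℝ}

lemma integrable_continuation (hb : Bounded h) (X : Multiset ℕ) (e : ℕ) (n : ℕ → ℕ) :
    Integrable (fun p : Multiset ℕ × ℕ => h ⟨age X + p.1, fun k => n (k + 1), p.2⟩)
      (m.arrivalLaw e) := by
  obtain ⟨R, hR⟩ := hb
  exact Integrable.of_bound (Measurable.of_discrete).aestronglyMeasurable R
    (Eventually.of_forall fun p => hR _)

lemma continuation_mono (hb : Bounded h) (hb' : Bounded h') (hle : ∀ z, h z ≤ h' z)
    (X : Multiset ℕ) (e : ℕ) (n : ℕ → ℕ) :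
    m.continuation h X e n ≤ m.continuation h' X e n :=
  integral_mono (integrable_continuation hb X e n) (integrable_continuation hb' X e n)
    fun _ => hle _

lemma abs_continuation_le {R : ℝ} (hR : ∀ z, |h z| ≤ R) (X : Multiset ℕ) (e : ℕ) (n : ℕ → ℕ) :
    |m.continuation h X e n| ≤ R := by
  have := norm_integral_le_of_norm_le_const (μ := m.arrivalLaw e)
    (f := fun p => h ⟨age X + p.1, fun k => n (k + 1), p.2⟩) (C := R)
    (Eventually.of_forall fun p => hR _)
  rwa [probReal_univ, mul_one] at this

lemma measurable_slotValue (X : Multiset ℕ) (e : ℕ) (n : ℕ → ℕ) :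
    Measurable (m.slotValue h X e n) := by
  refine Continuous.measurable ?_
  unfold slotValue
  exact Continuous.finset_inf'_apply _ fun a _ => by fun_prop

lemma abs_slotValue_le {R : ℝ} (hR : ∀ z, |h z| ≤ R) (X : Multiset ℕ) (e : ℕ) (n : ℕ → ℕ)
    {c : ℝ} (h0 : 0 < c) (hc : c ≤ m.Cmax) : |m.slotValue h X e n c| ≤ m.Cmax * m.B + R := by
  obtain ⟨a, ha, hs⟩ := inf'_range_exists m.B
    fun a => c * a + m.continuation h X e (fillTo (m.bound X) n a)
  rw [slotValue, hs]
  have h1 := abs_le.1 (abs_continuation_le (m := m) hR X e (fillTo (m.bound X) n a))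
  have h2 : c * a ≤ m.Cmax * m.B := by
    have : (a : ℝ) ≤ m.B := by exact_mod_cast ha
    have := m.Cmax_pos.le
    gcongr
  have h3 : 0 ≤ c * a := by positivity
  rw [abs_le]
  constructor <;> linarith

lemma integrable_slotValue (hb : Bounded h) (X : Multiset ℕ) (e : ℕ) (n : ℕ → ℕ) :
    Integrable (m.slotValue h X e n) m.C := by
  obtain ⟨R, hR⟩ := hb
  refine Integrable.of_bound (measurable_slotValue X e n).aestronglyMeasurable
    (m.Cmax * m.B + R) ?_
  filter_upwards [m.C_mem] with c hc using abs_slotValue_le hR X e n hc.1 hc.2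

lemma bounded_bellman (hb : Bounded h) (g : ℝ) : Bounded (m.bellman g h) := by
  obtain ⟨R, hR⟩ := hb
  have hR0 : 0 ≤ R := (abs_nonneg _).trans (hR ⟨0, 0, 0⟩)
  have hC := m.Cmax_pos.le
  have hm := m.meanCost_nonneg
  refine ⟨m.meanCost * m.maxContents + (m.Cmax * m.B + R) + |g|, fun z => ?_⟩
  unfold bellman
  split_ifs with h0
  · refine (abs_sub _ _).trans ?_
    rw [abs_of_nonneg (by positivity)]
    have : ((min z.contents.card m.maxContents - z.fill 0 : ℕ) : ℝ) ≤ m.maxContents := by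
      exact_mod_cast (Nat.sub_le _ _).trans (min_le_right _ _)
    have : m.meanCost * ((min z.contents.card m.maxContents - z.fill 0 : ℕ) : ℝ) ≤
        m.meanCost * m.maxContents := by gcongr
    have : 0 ≤ m.Cmax * m.B := by positivity
    linarith
  · refine (abs_sub _ _).trans ?_
    have := norm_integral_le_of_norm_le_const (μ := m.C)
      (f := m.slotValue h z.contents z.elapsed z.fill) (C := m.Cmax * m.B + R) (by
        filter_upwards [m.C_mem] with c hc using abs_slotValue_le hR _ _ _ hc.1 hc.2)
    simp only [Real.norm_eq_abs, probReal_univ, mul_one] at this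
    have : 0 ≤ m.meanCost * m.maxContents := by positivity
    linarith

lemma slotValue_mono (hb : Bounded h) (hb' : Bounded h') (hle : ∀ z, h z ≤ h' z)
    (X : Multiset ℕ) (e : ℕ) (n : ℕ → ℕ) (c : ℝ) :
    m.slotValue h X e n c ≤ m.slotValue h' X e n c := by
  obtain ⟨a, ha, hs⟩ := inf'_range_exists m.B
    fun a => c * a + m.continuation h' X e (fillTo (m.bound X) n a)
  rw [slotValue, slotValue, hs]
  exact (inf'_range_le _ ha).trans
    (by have := continuation_mono (m := m) hb hb' hle X e (fillTo (m.bound X) n a); linarith)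

lemma bellman_mono (hb : Bounded h) (hb' : Bounded h') (hle : ∀ z, h z ≤ h' z) (g : ℝ)
    (z : Reduced) : m.bellman g h z ≤ m.bellman g h' z := by
  unfold bellman
  split_ifs
  · rfl
  · exact sub_le_sub_right (integral_mono (integrable_slotValue hb _ _ _)
      (integrable_slotValue hb' _ _ _) (slotValue_mono hb hb' hle _ _ _)) _

/-! ### Structure preserved by the Bellman operator -/

/-- The structure of the relative value function: antitone and L♮-convex in the rank function
of the cache. -/
structure Regular (h : Reduced → ℝ) : Prop where
  antitone : ∀ X e, Antitone fun n => h ⟨X, n, e⟩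
  lnatural : ∀ X e, LNatural fun n => h ⟨X, n, e⟩

lemma Regular.continuation_antitone (hr : Regular h) (hb : Bounded h) (X : Multiset ℕ) (e : ℕ) :
    Antitone (m.continuation h X e) := fun n n' hn =>
  integral_mono (integrable_continuation hb X e n') (integrable_continuation hb X e n)
    fun _ => hr.antitone _ _ fun k => hn (k + 1)

lemma Regular.continuation_lnatural (hr : Regular h) (hb : Bounded h) (X : Multiset ℕ) (e : ℕ) :
    LNatural (m.continuation h X e) := by
  intro p q α
  have hi := fun n => integrable_continuation (m := m) hb X e n
  have h1 := integral_mono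
    ((hi fun k => max (p k - α) (q k)).add (hi fun k => min (p k) (q k + α)))
    ((hi p).add (hi q))
    fun x => hr.lnatural _ _ (fun k => p (k + 1)) (fun k => q (k + 1)) α
  exact (integral_add' (hi fun k => max (p k - α) (q k))
    (hi fun k => min (p k) (q k + α))).symm.le.trans
    (h1.trans_eq (integral_add' (hi _) (hi _)))

lemma Regular.bellman (hr : Regular h) (hb : Bounded h) (g : ℝ) : Regular (m.bellman g h) := by
  constructor
  · intro X e n n' hn
    simp only [Model.bellman]
    split_ifs
    · have h1 : ((min X.card m.maxContents - n' 0 : ℕ) : ℝ) ≤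
          (min X.card m.maxContents - n 0 : ℕ) := by
        exact_mod_cast Nat.sub_le_sub_left (hn 0) _
      have := mul_le_mul_of_nonneg_left h1 m.meanCost_nonneg
      linarith
    · exact sub_le_sub_right (integral_mono (integrable_slotValue hb _ _ _)
        (integrable_slotValue hb _ _ _) fun c =>
          antitone_inf_shift (hr.continuation_antitone hb X e) _ _ c hn) _
  · intro X e p q α
    simp only [Model.bellman]
    split_ifs
    · have h1 : ((min X.card m.maxContents - max (p 0 - α) (q 0) : ℕ) : ℝ) +
          (min X.card m.maxContents - min (p 0) (q 0 + α) : ℕ) ≤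
          (min X.card m.maxContents - p 0 : ℕ) + (min X.card m.maxContents - q 0 : ℕ) := by
        norm_cast
        omega
      have := mul_le_mul_of_nonneg_left h1 m.meanCost_nonneg
      linarith
    · have h1 := integral_mono
        ((integrable_slotValue (m := m) hb X e (fun k => max (p k - α) (q k))).add
          (integrable_slotValue hb X e (fun k => min (p k) (q k + α))))
        ((integrable_slotValue hb X e p).add (integrable_slotValue hb X e q))
        fun c => (hr.continuation_lnatural hb X e).inf_shift (hr.continuation_antitone hb X e)
          (m.bound X) m.B c p q α
      rw [integral_add' (integrable_slotValue hb _ _ _) (integrable_slotValue hb _ _ _),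
        integral_add' (integrable_slotValue hb _ _ _) (integrable_slotValue hb _ _ _)] at h1
      linarith

end Model

/-! ### Contraction -/

/-- Accesses occur uniformly often: some bounded weight of the user state decreases in mean by a
fixed factor in every slot without access. -/
lemma AccessModel.exists_weight (A : AccessModel) :
    ∃ (w : ℕ → ℝ) (ρ R : ℝ), 0 ≤ ρ ∧ ρ < 1 ∧ (∀ e, 1 ≤ w e) ∧ (∀ e, w e ≤ R) ∧
      ∀ e, e ≠ 0 → ∫ x, w x ∂(A.next e).toMeasure ≤ ρ * w e := by
  cases A with
  | bounded D Dmax hD =>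
    -- the weight is, up to constants, the number of slots until an access is certain
    set w : ℕ → ℝ := fun e => if e = 0 then 1 else ((2 + (Dmax - e) : ℕ) : ℝ) with hw
    have hw1 : ∀ e, 1 ≤ w e := fun e => by
      simp only [hw]
      split_ifs
      · exact le_rfl
      · exact_mod_cast (by omega : 1 ≤ 2 + (Dmax - e))
    have hwR : ∀ e, w e ≤ Dmax + 2 := fun e => by
      simp only [hw]
      split_ifs
      · have : (0 : ℝ) ≤ Dmax := by positivity
        linarith
      · exact_mod_cast (by omega : 2 + (Dmax - e) ≤ Dmax + 2)
    refine ⟨w, 1 - 1 / (Dmax + 2), Dmax + 2, ?_, ?_, hw1, hwR, fun e he => ?_⟩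
    · rw [sub_nonneg, div_le_one (by positivity)]
      have : (0 : ℝ) ≤ Dmax := by positivity
      linarith
    · have : (0 : ℝ) < 1 / (Dmax + 2) := by positivity
      linarith
    have hsupp : ∀ x ∈ ((AccessModel.bounded D Dmax hD).next e).support, w x ≤ w e - 1 := by
      intro x hx
      have h0 : w 0 ≤ w e - 1 := by
        simp only [hw, if_true, if_neg he]
        push_cast
        have : (0 : ℝ) ≤ ((Dmax - e : ℕ) : ℝ) := by positivity
        linarith
      simp only [AccessModel.next] at hx
      split_ifs at hx with hex
      · rw [PMF.mem_support_map_iff] at hx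
        obtain ⟨d, hd, rfl⟩ := hx
        rw [PMF.mem_support_filter_iff] at hd
        split_ifs with hde
        · exact h0
        · have h1 := (hD d hd.2).2
          have h2 : e < d := hd.1
          simp only [hw, if_neg he, if_neg (Nat.succ_ne_zero e)]
          rw [le_sub_iff_add_le]
          exact_mod_cast (by omega : 2 + (Dmax - (e + 1)) + 1 ≤ 2 + (Dmax - e))
      · rw [PMF.support_pure, Set.mem_singleton_iff] at hx
        rw [hx]
        exact h0
    have hae : ∀ᵐ x ∂((AccessModel.bounded D Dmax hD).next e).toMeasure, w x ≤ w e - 1 := by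
      rw [ae_iff, PMF.toMeasure_apply_eq_zero_iff _ (MeasurableSet.of_discrete),
        Set.disjoint_left]
      exact fun x hx hx' => hx' (hsupp x hx)
    have hint : Integrable w ((AccessModel.bounded D Dmax hD).next e).toMeasure :=
      Integrable.of_bound Measurable.of_discrete.aestronglyMeasurable (Dmax + 2 : ℝ)
        (Eventually.of_forall fun x => by
          rw [Real.norm_eq_abs, abs_of_nonneg (zero_le_one.trans (hw1 x))]; exact hwR x)
    calc _ ≤ ∫ _, (w e - 1) ∂((AccessModel.bounded D Dmax hD).next e).toMeasure :=
          integral_mono_ae hint (integrable_const _) hae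
      _ = w e - 1 := by simp
      _ ≤ (1 - 1 / (Dmax + 2)) * w e := by
          have h3 : 1 / ((Dmax : ℝ) + 2) * w e ≤ 1 := by
            rw [one_div_mul_eq_div, div_le_one (by positivity)]
            exact hwR e
          linarith
  | geometric U hU =>
    have hp : 0 < (U true).toReal := ENNReal.toReal_pos hU.ne' (PMF.apply_ne_top _ _)
    have hsum : (U true).toReal + (U false).toReal = 1 := by
      have := PMF.tsum_coe U
      rw [tsum_fintype, Fintype.sum_bool] at this
      rw [← ENNReal.toReal_add (PMF.apply_ne_top _ _) (PMF.apply_ne_top _ _), this]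
      rfl
    have hq : 0 ≤ (U false).toReal := ENNReal.toReal_nonneg
    refine ⟨fun e => if e = 0 then 1 else 2, 1 - (U true).toReal / 2, 2, by linarith,
      by linarith, fun e => by dsimp only; split_ifs <;> norm_num,
      fun e => by dsimp only; split_ifs <;> norm_num,
      fun e he => ?_⟩
    simp only [AccessModel.next]
    rw [← PMF.toMeasure_map _ _ Measurable.of_discrete, integral_map
      Measurable.of_discrete.aemeasurable Measurable.of_discrete.aestronglyMeasurable,
      PMF.integral_eq_sum]
    simp only [Fintype.sum_bool, if_true, smul_eq_mul, if_neg he, Bool.false_eq_true, if_false,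
      one_ne_zero]
    linarith

namespace Model

variable {m : Model} {h h' : Reduced → ℝ}

lemma abs_continuation_sub_le (hb : Bounded h) (hb' : Bounded h') {w : ℕ → ℝ} {R d ρ : ℝ}
    (hw1 : ∀ e, 1 ≤ w e) (hwR : ∀ e, w e ≤ R) (hd : 0 ≤ d)
    (hle : ∀ z, |h z - h' z| ≤ d * w z.elapsed) {e : ℕ}
    (hw : ∫ x, w x ∂(m.access.next e).toMeasure ≤ ρ * w e) (X : Multiset ℕ) (n : ℕ → ℕ) :
    |m.continuation h X e n - m.continuation h' X e n| ≤ ρ * d * w e := by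
  have hint : Integrable (fun p : Multiset ℕ × ℕ => d * w p.2) (m.arrivalLaw e) :=
    (Integrable.of_bound Measurable.of_discrete.aestronglyMeasurable R
      (Eventually.of_forall fun p => by
        rw [Real.norm_eq_abs, abs_of_nonneg (zero_le_one.trans (hw1 _))]
        exact hwR _)).const_mul d
  unfold continuation
  rw [← integral_sub (integrable_continuation hb X e n) (integrable_continuation hb' X e n)]
  have key := norm_integral_le_of_norm_le
    (f := fun p : Multiset ℕ × ℕ => h ⟨age X + p.1, fun k => n (k + 1), p.2⟩ -
      h' ⟨age X + p.1, fun k => n (k + 1), p.2⟩) hint (Eventually.of_forall fun p => hle _)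
  refine key.trans ?_
  calc ∫ p : Multiset ℕ × ℕ, d * w p.2 ∂m.arrivalLaw e
      = d * ∫ x, w x ∂(m.access.next e).toMeasure := by
        rw [integral_const_mul, ← map_snd_arrivalLaw,
          integral_map measurable_snd.aemeasurable Measurable.of_discrete.aestronglyMeasurable]
    _ ≤ d * (ρ * w e) := mul_le_mul_of_nonneg_left hw hd
    _ = ρ * d * w e := by ring

lemma abs_bellman_sub_le (hb : Bounded h) (hb' : Bounded h') {w : ℕ → ℝ} {R d ρ : ℝ}
    (hw1 : ∀ e, 1 ≤ w e) (hwR : ∀ e, w e ≤ R) (hd : 0 ≤ d) (hρ : 0 ≤ ρ)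
    (hle : ∀ z, |h z - h' z| ≤ d * w z.elapsed)
    (hw : ∀ e, e ≠ 0 → ∫ x, w x ∂(m.access.next e).toMeasure ≤ ρ * w e) (g : ℝ) (z : Reduced) :
    |m.bellman g h z - m.bellman g h' z| ≤ ρ * d * w z.elapsed := by
  unfold bellman
  split_ifs with h0
  · have := zero_le_one.trans (hw1 z.elapsed)
    rw [sub_self, abs_zero]
    positivity
  · rw [sub_sub_sub_cancel_right, ← integral_sub (integrable_slotValue hb _ _ _)
      (integrable_slotValue hb' _ _ _)]
    have := norm_integral_le_of_norm_le_const (μ := m.C)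
      (f := fun c => m.slotValue h z.contents z.elapsed z.fill c -
        m.slotValue h' z.contents z.elapsed z.fill c) (C := ρ * d * w z.elapsed)
      (Eventually.of_forall fun c => abs_inf'_sub_inf'_le fun a => by
        rw [add_sub_add_left_eq_sub]
        exact abs_continuation_sub_le hb hb' hw1 hwR hd hle (hw _ h0) _ _)
    rwa [probReal_univ, mul_one] at this

lemma bellman_const_sub (g g' : ℝ) (h : Reduced → ℝ) (z : Reduced) :
    m.bellman g h z - m.bellman g' h z = g' - g := by
  unfold bellman
  split_ifs <;> ring

variable (m)

/-- For every `g`, value iteration for the stopped problem converges to a bounded fixed point of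
the Bellman operator, which is Lipschitz continuous in `g`. -/
theorem exists_fixedPoint :
    ∃ v : ℝ → Reduced → ℝ, (∀ g, Bounded (v g)) ∧ (∀ g, m.bellman g (v g) = v g) ∧
      (∀ g z, Tendsto (fun k => (m.bellman g)^[k] 0 z) atTop (nhds (v g z))) ∧
      ∃ L, ∀ g g' z, |v g z - v g' z| ≤ L * |g - g'| := by
  obtain ⟨w, ρ, R, hρ0, hρ1, hw1, hwR, hw⟩ := m.access.exists_weight
  have hw0 : ∀ e, 0 < w e := fun e => zero_lt_one.trans_le (hw1 e)
  have hR0 : 0 ≤ R := (hw0 0).le.trans (hwR 0)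
  have hscale : ∀ u : BoundedContinuousFunction Reduced ℝ,
      Bounded fun z => w z.elapsed * u z := fun u => ⟨R * ‖u‖, fun z => by
    rw [abs_mul, abs_of_pos (hw0 _)]
    exact mul_le_mul (hwR _) (u.norm_coe_le_norm z) (abs_nonneg _) hR0⟩
  -- the Bellman operator, conjugated by the weight
  have hbound : ∀ (g : ℝ) (u : BoundedContinuousFunction Reduced ℝ), ∃ S, ∀ z,
      ‖m.bellman g (fun z => w z.elapsed * u z) z / w z.elapsed‖ ≤ S := fun g u => by
    obtain ⟨S, hS⟩ := bounded_bellman (m := m) (hscale u) g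
    refine ⟨S, fun z => ?_⟩
    rw [norm_div, Real.norm_of_nonneg (hw0 _).le]
    exact (div_le_self (norm_nonneg _) (hw1 _)).trans (hS z)
  choose S hS using hbound
  set Φ : ℝ → BoundedContinuousFunction Reduced ℝ → BoundedContinuousFunction Reduced ℝ :=
    fun g u => BoundedContinuousFunction.ofNormedAddCommGroupDiscrete _ (S g u) (hS g u) with hΦ
  have hΦa : ∀ g u z, w z.elapsed * Φ g u z =
      m.bellman g (fun z => w z.elapsed * u z) z := fun g u z =>
    mul_div_cancel₀ _ (hw0 _).ne'
  have hcontr : ∀ g, ContractingWith ⟨ρ, hρ0⟩ (Φ g) := fun g => by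
    refine ⟨by exact_mod_cast hρ1, LipschitzWith.of_dist_le_mul fun u u' => ?_⟩
    refine (BoundedContinuousFunction.dist_le (by positivity)).2 fun z => ?_
    have h1 := abs_bellman_sub_le (hscale u) (hscale u') hw1 hwR (dist_nonneg (x := u) (y := u'))
      hρ0 (fun z => by
        rw [← mul_sub, abs_mul, abs_of_pos (hw0 _), mul_comm]
        exact mul_le_mul_of_nonneg_right (u.dist_coe_le_dist z) (hw0 _).le) hw g z
    rw [← hΦa, ← hΦa, ← mul_sub, abs_mul, abs_of_pos (hw0 _), mul_comm] at h1
    exact le_of_mul_le_mul_right h1 (hw0 _)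
  set u : ℝ → BoundedContinuousFunction Reduced ℝ :=
    fun g => ContractingWith.fixedPoint (Φ g) (hcontr g) with hu
  refine ⟨fun g z => w z.elapsed * u g z, fun g => hscale _, fun g => ?_, fun g z => ?_,
    R * (1 / (1 - ρ)), fun g g' z => ?_⟩
  · funext z
    rw [← hΦa, (hcontr g).fixedPoint_isFixedPt]
  · have hiter : ∀ k, (m.bellman g)^[k] 0 = fun z => w z.elapsed * ((Φ g)^[k] 0) z := by
      intro k
      induction k with
      | zero => funext z; simp
      | succ k ih =>
        funext z
        rw [Function.iterate_succ_apply', Function.iterate_succ_apply', hΦa, ih]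
    have h1 := (hcontr g).tendsto_iterate_fixedPoint 0
    have h2 : Tendsto (fun k => ((Φ g)^[k] 0) z) atTop (nhds (u g z)) :=
      ((BoundedContinuousFunction.tendsto_iff_tendstoUniformly.1 h1).tendsto_at z)
    simpa only [hiter] using h2.const_mul (w z.elapsed)
  · have h1 := (hcontr g).fixedPoint_lipschitz_in_map (hcontr g') (C := |g - g'|) fun v => by
      refine (BoundedContinuousFunction.dist_le (abs_nonneg _)).2 fun z => ?_
      have h2 : w z.elapsed * |Φ g v z - Φ g' v z| = |g - g'| := by
        have h4 : w z.elapsed * (Φ g v z - Φ g' v z) = g' - g := by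
          rw [mul_sub, hΦa, hΦa, bellman_const_sub]
        rw [abs_sub_comm g g', ← h4, abs_mul, abs_of_pos (hw0 _)]
      rw [Real.dist_eq, ← h2]
      exact le_mul_of_one_le_left (abs_nonneg _) (hw1 _)
    have h3 := (BoundedContinuousFunction.dist_coe_le_dist z).trans h1
    rw [Real.dist_eq] at h3
    rw [← mul_sub, abs_mul, abs_of_pos (hw0 _)]
    refine (mul_le_mul (hwR _) h3 (abs_nonneg _) hR0).trans_eq ?_
    change R * (|g - g'| / (1 - ρ)) = _
    ring

/-- A solution of the average cost optimality equation: the optimal average cost `g`, and the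
relative value function `h`, normalized so that it has mean zero after an access. -/
structure IsSolution (g : ℝ) (h : Reduced → ℝ) : Prop where
  nonneg : 0 ≤ g
  bounded : Bounded h
  regular : Regular h
  fixed : m.bellman g h = h
  normalized : ∫ p, h ⟨p.1, 0, p.2⟩ ∂m.arrivalLaw 0 = 0

theorem exists_isSolution : ∃ g h, m.IsSolution g h := by
  obtain ⟨v, hvb, hvf, hvt, L, hL⟩ := m.exists_fixedPoint
  have hb0 : Bounded (0 : Reduced → ℝ) := ⟨0, fun z => by simp⟩
  have hiterb : ∀ g k, Bounded ((m.bellman g)^[k] 0) := fun g k => by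
    induction k with
    | zero => exact hb0
    | succ k ih => rw [Function.iterate_succ_apply']; exact bounded_bellman ih g
  have hiterr : ∀ g k, Regular ((m.bellman g)^[k] 0) := fun g k => by
    induction k with
    | zero => exact ⟨fun _ _ _ _ _ => le_rfl, fun _ _ _ _ _ => le_rfl⟩
    | succ k ih => rw [Function.iterate_succ_apply']; exact ih.bellman (hiterb g k) g
  have hreg : ∀ g, Regular (v g) := fun g =>
    ⟨fun X e n n' hn => le_of_tendsto_of_tendsto' (hvt g _) (hvt g _)
        fun k => (hiterr g k).antitone X e hn,
      fun X e p q α => le_of_tendsto_of_tendsto' ((hvt g _).add (hvt g _))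
        ((hvt g _).add (hvt g _)) fun k => (hiterr g k).lnatural X e p q α⟩
  have hint : ∀ g, Integrable (fun p : Multiset ℕ × ℕ => v g ⟨p.1, 0, p.2⟩) (m.arrivalLaw 0) :=
    fun g => by
      obtain ⟨R, hR⟩ := hvb g
      exact Integrable.of_bound Measurable.of_discrete.aestronglyMeasurable R
        (Eventually.of_forall fun p => hR _)
  -- the mean after an access is continuous in `g` and changes sign, so it vanishes somewhere
  set f : ℝ → ℝ := fun g => ∫ p, v g ⟨p.1, 0, p.2⟩ ∂m.arrivalLaw 0 with hf
  have hcont : Continuous f := by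
    refine (LipschitzWith.of_dist_le_mul (K := L.toNNReal) fun g g' => ?_).continuous
    simp only [hf, Real.dist_eq]
    rw [← integral_sub (hint g) (hint g')]
    have := norm_integral_le_of_norm_le_const (μ := m.arrivalLaw 0)
      (f := fun p => v g ⟨p.1, 0, p.2⟩ - v g' ⟨p.1, 0, p.2⟩) (C := L.toNNReal * |g - g'|)
      (Eventually.of_forall fun p => (hL g g' _).trans
        (mul_le_mul_of_nonneg_right (Real.le_coe_toNNReal L) (abs_nonneg _)))
    rwa [probReal_univ, mul_one] at this
  set G : ℝ := m.meanCost * m.maxContents with hG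
  have hG0 : 0 ≤ G := mul_nonneg m.meanCost_nonneg (Nat.cast_nonneg _)
  have hc0 : ∀ X e n, m.continuation 0 X e n = 0 := fun X e n => by simp [continuation]
  have hlow : ∀ z, 0 ≤ m.bellman 0 0 z := fun z => by
    unfold bellman
    split_ifs
    · have := m.meanCost_nonneg
      rw [sub_zero]
      positivity
    · rw [sub_zero]
      refine integral_nonneg_of_ae ?_
      filter_upwards [m.C_mem] with c hc
      refine Finset.le_inf' _ _ fun a _ => ?_
      rw [hc0]
      have := hc.1.le
      simp only [Pi.zero_apply, add_zero]
      positivity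
  have hhigh : ∀ z, m.bellman G 0 z ≤ 0 := fun z => by
    unfold bellman
    split_ifs
    · rw [sub_nonpos]
      refine mul_le_mul_of_nonneg_left ?_ m.meanCost_nonneg
      exact_mod_cast (Nat.sub_le _ _).trans (min_le_right _ _)
    · have : ∫ c, m.slotValue 0 z.contents z.elapsed z.fill c ∂m.C ≤ 0 :=
        integral_nonpos fun c => (inf'_range_le _ (Nat.zero_le _)).trans_eq (by simp [hc0])
      linarith
  have h0 : 0 ≤ f 0 := integral_nonneg fun p => ge_of_tendsto' (hvt 0 _) fun k => by
    have : ∀ z, 0 ≤ (m.bellman 0)^[k] 0 z := by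
      induction k with
      | zero => exact fun z => le_rfl
      | succ k ih =>
        intro z
        rw [Function.iterate_succ_apply']
        exact (hlow z).trans (bellman_mono hb0 (hiterb 0 k) ih 0 z)
    exact this _
  have h1 : f G ≤ 0 := integral_nonpos fun p => le_of_tendsto' (hvt G _) fun k => by
    have : ∀ z, (m.bellman G)^[k] 0 z ≤ 0 := by
      induction k with
      | zero => exact fun z => le_rfl
      | succ k ih =>
        intro z
        rw [Function.iterate_succ_apply']
        exact (bellman_mono (hiterb G k) hb0 ih G z).trans (hhigh z)
    exact this _
  obtain ⟨g, hg, hg0⟩ := intermediate_value_Icc' hG0 hcont.continuousOn ⟨h1, h0⟩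
  exact ⟨g, v g, hg.1, hvb g, hreg g, hvf g, hg0⟩

end Model

/-! ### Swaps and rank functions -/

lemma countP_drop_of_ascending {l : List ℕ} (hl : l.Pairwise (· ≤ ·)) (j k : ℕ) :
    (l.drop j).countP (k < ·) = min (l.countP (k < ·)) (l.length - j) := by
  induction l generalizing j with
  | nil => simp
  | cons a t ih =>
    rw [List.pairwise_cons] at hl
    have hle : t.countP (k < ·) ≤ t.length := List.countP_le_length
    rcases j with _ | j
    · have : (a :: t).countP (k < ·) ≤ (a :: t).length := List.countP_le_length
      simp only [List.drop_zero, Nat.sub_zero]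
      omega
    · rw [List.drop_succ_cons, ih hl.2, List.countP_cons, List.length_cons]
      by_cases ha : k < a
      · have : t.countP (k < ·) = t.length :=
          List.countP_eq_length.2 fun x hx => by simpa using ha.trans_le (hl.1 x hx)
        simp only [ha, decide_true, if_true]
        omega
      · simp only [ha, decide_false, Bool.false_eq_true, if_false]
        omega

lemma countP_take_of_descending {l : List ℕ} (hl : l.Pairwise (· ≥ ·)) (j k : ℕ) :
    (l.take j).countP (k < ·) = min j (l.countP (k < ·)) := by
  induction l generalizing j with
  | nil => simp
  | cons a t ih =>
    rw [List.pairwise_cons] at hl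
    rcases j with _ | j
    · simp
    · rw [List.take_succ_cons, List.countP_cons, List.countP_cons, ih hl.2]
      by_cases ha : k < a
      · simp only [ha, decide_true, if_true]
        omega
      · have : t.countP (k < ·) = 0 :=
          List.countP_eq_zero.2 fun x hx => by
            have := hl.1 x hx
            simp only [decide_eq_true_eq]
            omega
        simp only [ha, decide_false, Bool.false_eq_true, if_false]
        omega

lemma map_getD_range (l : List ℕ) (j : ℕ) :
    (List.range j).map (fun i => l.getD i 0) = l.take j ++ List.replicate (j - l.length) 0 := by
  induction j with
  | zero => simp
  | succ j ih =>
    rw [List.range_succ, List.map_append, ih]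
    rcases lt_or_ge j l.length with h | h
    · rw [List.take_succ_eq_append_getElem h, Nat.sub_eq_zero_of_le h.le, Nat.sub_eq_zero_of_le h]
      simp [h]
    · rw [List.take_of_length_le h, List.take_of_length_le (h.trans (Nat.le_succ _)),
        Nat.succ_sub h, List.replicate_succ']
      simp [h]

lemma map_initial_segment {B j : ℕ} (hj : j ≤ B) (l : List ℕ) :
    ((Finset.univ.filter fun i : Fin B => (i : ℕ) < j).val.map fun i : Fin B =>
      l.getD (i : ℕ) 0) =
      ((l.take j ++ List.replicate (j - l.length) 0 : List ℕ) : Multiset ℕ) := by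
  have h : (Finset.univ.filter fun i : Fin B => (i : ℕ) < j).map Fin.valEmbedding =
      Finset.range j := by
    ext x
    simp only [Finset.mem_map, Finset.mem_filter, Finset.mem_univ, true_and,
      Fin.valEmbedding_apply, Finset.mem_range]
    exact ⟨fun ⟨i, hi, hx⟩ => hx ▸ hi, fun hx => ⟨⟨x, hx.trans_le hj⟩, hx, rfl⟩⟩
  have h2 : (Finset.univ.filter fun i : Fin B => (i : ℕ) < j).val.map (fun i : Fin B => (i : ℕ)) =
      Multiset.range j := congrArg Finset.val h
  rw [← map_getD_range]
  have h3 := congrArg (Multiset.map fun i => l.getD i 0) h2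
  rw [Multiset.map_map] at h3
  exact h3

lemma map_univ_getD (B : ℕ) (l : List ℕ) :
    ((Finset.univ : Finset (Fin B)).val.map fun i : Fin B => l.getD (i : ℕ) 0) =
      ((l.take B ++ List.replicate (B - l.length) 0 : List ℕ) : Multiset ℕ) := by
  rw [← map_initial_segment le_rfl]
  simp

lemma rank_filter_pos (Z : Multiset ℕ) (k : ℕ) : rank (Z.filter (0 < ·)) k = rank Z k := by
  unfold rank
  rw [Multiset.countP_filter]
  refine Multiset.countP_congr rfl fun x _ => ?_
  simp only [eq_iff_iff]
  omega

lemma rank_replicate_zero (n k : ℕ) : rank (Multiset.replicate n 0) k = 0 :=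
  Multiset.countP_eq_zero.2 fun x hx => by simp [Multiset.eq_of_mem_replicate hx]

lemma rank_coe (l : List ℕ) (k : ℕ) : rank (l : Multiset ℕ) k = l.countP (k < ·) :=
  Multiset.coe_countP _ _

/-- The invariant of the controlled chain: the constraints on a state other than the one on the
user state. -/
structure Model.Valid (m : Model) (s : State) : Prop where
  lifetime : ∀ z ∈ s.out + s.cache, 1 ≤ z ∧ z ≤ m.Kmax
  count : ∀ k, (s.out + s.cache).countP (k ≤ ·) ≤ m.Mmax * (m.Kmax + 1 - k)
  capacity : s.cache.card ≤ m.B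

lemma Model.IsState.valid {m : Model} {s : State} (h : m.IsState s) : m.Valid s :=
  ⟨h.lifetime, h.count, h.capacity⟩

section Swaps

variable {m : Model} {s : State}

/-- The cache in increasing order, with free places as zeros. -/
def cacheList (m : Model) (s : State) : List ℕ :=
  (s.cache + Multiset.replicate (m.B - s.cache.card) 0).sort (· ≤ ·)

lemma coe_cacheList : (cacheList m s : Multiset ℕ) =
    s.cache + Multiset.replicate (m.B - s.cache.card) 0 := Multiset.sort_eq _ _

lemma length_cacheList (h : s.cache.card ≤ m.B) : (cacheList m s).length = m.B := by
  rw [cacheList, Multiset.length_sort, Multiset.card_add, Multiset.card_replicate]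
  omega

lemma map_cached_univ (h : s.cache.card ≤ m.B) :
    (Finset.univ : Finset (Fin m.B)).val.map (cached m s) =
      s.cache + Multiset.replicate (m.B - s.cache.card) 0 := by
  rw [← coe_cacheList]
  refine (map_univ_getD _ (cacheList m s)).trans ?_
  rw [List.take_of_length_le (length_cacheList h).le, length_cacheList h]
  simp

lemma swaps_download_le (J : Finset (Fin m.B)) : (swaps m s J).download ≤ s.out := by
  have h1 : J.val.map (outside m s) ≤ (Finset.univ : Finset (Fin m.B)).val.map (outside m s) :=
    Multiset.map_le_map (Finset.val_le_iff.2 (Finset.subset_univ J))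
  have h2 := (map_univ_getD m.B (s.out.sort (· ≥ ·)))
  refine (Multiset.filter_le_filter _ (h1.trans_eq h2)).trans ?_
  rw [← Multiset.coe_add, Multiset.filter_add, ← Multiset.replicate,
    (Multiset.filter_eq_nil (s := Multiset.replicate _ 0)).2 fun a ha => by
      simp [Multiset.eq_of_mem_replicate ha], add_zero]
  refine (Multiset.filter_le _ _).trans ?_
  conv_rhs => rw [← Multiset.sort_eq s.out (· ≥ ·)]
  exact (List.take_sublist _ _).subperm

lemma swaps_discard_le (h : s.cache.card ≤ m.B) (J : Finset (Fin m.B)) :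
    (swaps m s J).discard ≤ s.cache := by
  have h1 : J.val.map (cached m s) ≤ (Finset.univ : Finset (Fin m.B)).val.map (cached m s) :=
    Multiset.map_le_map (Finset.val_le_iff.2 (Finset.subset_univ J))
  refine (Multiset.filter_le_filter _ (h1.trans_eq (map_cached_univ h))).trans ?_
  rw [Multiset.filter_add, (Multiset.filter_eq_nil (s := Multiset.replicate _ 0)).2 fun a ha => by
      simp [Multiset.eq_of_mem_replicate ha], add_zero]
  exact Multiset.filter_le _ _

lemma card_swaps_le (hv : m.Valid s) (J : Finset (Fin m.B)) :
    (s.cache + (swaps m s J).download - (swaps m s J).discard).card ≤ m.B := by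
  have hcap := hv.capacity
  rw [Multiset.card_sub ((swaps_discard_le hcap J).trans (Multiset.le_add_right _ _)),
    Multiset.card_add]
  have h1 : (swaps m s J).download.card ≤ J.card :=
    (Multiset.card_le_card (Multiset.filter_le _ _)).trans_eq (Multiset.card_map _ _)
  -- the entries of `J` that are not discarded are free places
  have h2 : J.card = (swaps m s J).discard.card +
      (J.val.map (cached m s)).countP (fun x => ¬ 0 < x) := by
    have := Multiset.card_eq_countP_add_countP (0 < ·) (J.val.map (cached m s))
    rwa [Multiset.card_map, Multiset.countP_eq_card_filter] at this
  have h3 : (J.val.map (cached m s)).countP (fun x => ¬ 0 < x) ≤ m.B - s.cache.card := by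
    refine (Multiset.countP_le_of_le _ ((Multiset.map_le_map
      (Finset.val_le_iff.2 (Finset.subset_univ J))).trans_eq (map_cached_univ hcap))).trans ?_
    rw [Multiset.countP_add, Multiset.countP_eq_zero.2 fun x hx => by
      have := (hv.lifetime x (Multiset.mem_add.2 (Or.inr hx))).1
      omega, zero_add]
    exact (Multiset.countP_le_card _ _).trans_eq (Multiset.card_replicate _ _)
  omega

lemma feasible_swaps (hv : m.Valid s) (he : s.elapsed ≠ 0) (J : Finset (Fin m.B)) :
    m.Feasible s (swaps m s J) := by
  rw [Model.Feasible, if_neg he]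
  exact ⟨swaps_download_le J, swaps_discard_le hv.capacity J, card_swaps_le hv J⟩

/-- The action performing the first `j` swaps. -/
abbrev firstSwaps (m : Model) (s : State) (j : ℕ) : Action :=
  swaps m s (Finset.univ.filter fun i : Fin m.B => (i : ℕ) < j)

lemma rank_firstSwaps_download {j : ℕ} (hj : j ≤ m.B) (k : ℕ) :
    rank (firstSwaps m s j).download k = min j (rank s.out k) := by
  have h : (Finset.univ.filter fun i : Fin m.B => (i : ℕ) < j).val.map (outside m s) = _ :=
    map_initial_segment hj (s.out.sort (· ≥ ·))
  rw [firstSwaps, swaps, rank_filter_pos, h, ← Multiset.coe_add, rank_add, rank_coe,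
    countP_take_of_descending (Multiset.pairwise_sort _ _), ← rank_coe, Multiset.sort_eq]
  exact Nat.add_eq_left.2 (rank_replicate_zero _ _)

lemma rank_firstSwaps_discard (hcap : s.cache.card ≤ m.B) {j : ℕ} (hj : j ≤ m.B) (k : ℕ) :
    rank (firstSwaps m s j).discard k + min (rank s.cache k) (m.B - j) = rank s.cache k := by
  have h : (Finset.univ.filter fun i : Fin m.B => (i : ℕ) < j).val.map (cached m s) = _ :=
    map_initial_segment hj (cacheList m s)
  have h1 : (cacheList m s).countP (k < ·) = rank s.cache k := by
    rw [← rank_coe, coe_cacheList, rank_add, rank_replicate_zero, add_zero]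
  have h2 := countP_drop_of_ascending (l := cacheList m s) (Multiset.pairwise_sort _ _) j k
  have h3 : (cacheList m s).countP (k < ·) =
      ((cacheList m s).take j).countP (k < ·) + ((cacheList m s).drop j).countP (k < ·) := by
    rw [← List.countP_append, List.take_append_drop]
  rw [firstSwaps, swaps, rank_filter_pos, h, length_cacheList hcap, Nat.sub_eq_zero_of_le hj,
    List.replicate_zero, List.append_nil, rank_coe]
  rw [length_cacheList hcap, h1] at h2
  rw [h1, h2] at h3
  exact h3.symm

/-- If the rank function plus `j` does not exceed its bound at some `k`, then the first `j` swaps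
attain the upper bound for `j` downloads.  The hypothesis says that at least `j` contents outside
the cache have remaining lifetime greater than `k`, and at least `j` places of the cache do not hold
such a content; so `l_j ≤ k < L_j`. -/
lemma firstSwaps_spec (hv : m.Valid s) {j : ℕ} (hj : j ≤ m.B)
    (hk : ∃ k, rank s.cache k + j ≤ m.bound (s.out + s.cache) k) :
    rank (s.cache + (firstSwaps m s j).download - (firstSwaps m s j).discard) =
      fillTo (m.bound (s.out + s.cache)) (rank s.cache) j ∧
    (firstSwaps m s j).download.card = j := by
  obtain ⟨k₀, hk₀⟩ := hk
  simp only [Model.bound, rank_add] at hk₀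
  constructor
  · funext k
    have h1 := rank_action (A := (firstSwaps m s j).download)
      (D := (firstSwaps m s j).discard)
      (swaps_discard_le hv.capacity (Finset.univ.filter fun i : Fin m.B => (i : ℕ) < j)) k
    have h2 := rank_firstSwaps_discard hv.capacity hj k
    have h3 := rank_firstSwaps_download (s := s) hj k
    have h4 := (rank_le_card s.cache k).trans hv.capacity
    simp only [fillTo, Model.bound, rank_add]
    rcases le_total k k₀ with hkk | hkk
    · have := rank_anti s.out hkk
      omega
    · have := rank_anti s.cache hkk
      omega
  · have h3 := rank_firstSwaps_download (s := s) hj 0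
    have := rank_anti s.out (Nat.zero_le k₀)
    have h5 : rank (firstSwaps m s j).download 0 = (firstSwaps m s j).download.card :=
      rank_zero_eq_card fun z hz => by
        simp only [firstSwaps, swaps, Multiset.mem_filter] at hz
        exact hz.2
    omega

end Swaps

/-! ### Integration along the controlled chain -/

namespace Model

variable (m : Model)

lemma nextLaw_eq_map (s : State) (a : Action) :
    m.nextLaw s a = (m.arrivals s.elapsed).map fun p => nextState s a p.1 p.2 := by
  simp only [nextLaw, arrivals, PMF.map_bind, PMF.map_comp, Function.comp_def]

lemma transition_eq_map (s : State) (a : Action) :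
    m.transition (s, a) = (m.arrivalLaw s.elapsed).map fun p => nextState s a p.1 p.2 := by
  change (m.nextLaw s a).toMeasure = _
  rw [nextLaw_eq_map, arrivalLaw, PMF.toMeasure_map _ _ Measurable.of_discrete]

lemma lintegral_transition (F : State → ℝ≥0∞) (s : State) (a : Action) :
    ∫⁻ x, F x ∂m.transition (s, a) =
      ∫⁻ p, F (nextState s a p.1 p.2) ∂m.arrivalLaw s.elapsed := by
  rw [transition_eq_map, lintegral_map Measurable.of_discrete Measurable.of_discrete]

end Model

namespace Strategy

variable {m : Model} (σ : Strategy m)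

lemma lintegral_initial (s : State) {f : Slot → ℝ≥0∞} (hf : Measurable f) :
    ∫⁻ x, f x ∂σ.initial s =
      ∫⁻ c, ∫⁻ a, f ((s, c), a) ∂σ.act 0 (Fin.elim0, (s, c)) ∂m.C := by
  rw [initial, Measure.lintegral_compProd hf, lintegral_prod, lintegral_dirac]
  · rfl
  · exact (Measurable.lintegral_kernel_prod_right' hf).aemeasurable

lemma lintegral_step (n : ℕ) (η : Finset.Iic n → Slot) {f : Slot → ℝ≥0∞} (hf : Measurable f) :
    ∫⁻ x, f x ∂σ.step n η = ∫⁻ s, ∫⁻ c, ∫⁻ a, f ((s, c), a)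
      ∂σ.act (n + 1) (toTuple n η, (s, c)) ∂m.C ∂m.transition (last n η) := by
  rw [step, Kernel.lintegral_compProd _ _ _ hf, Kernel.prod_apply, lintegral_prod]
  · rfl
  · have := Measurable.lintegral_kernel_prod_right'
      (κ := (σ.act (n + 1)).comap (fun p : State × ℝ => (toTuple n η, p))
        (measurable_const.prodMk measurable_id)) hf
    exact this.aemeasurable

lemma map_frestrictLe_zero_law (s : State) :
    (σ.law s).map (Preorder.frestrictLe (π := fun _ => Slot) 0) =
      (σ.initial s).map (MeasurableEquiv.piUnique fun _ : Finset.Iic 0 => Slot).symm := by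
  rw [law, Kernel.trajMeasure, Measure.map_comp _ _ (Preorder.measurable_frestrictLe 0),
    Kernel.traj_map_frestrictLe, Kernel.partialTraj_self, Measure.id_comp]

instance (s : State) : IsProbabilityMeasure (σ.initial s) := by
  unfold initial; infer_instance

instance (s : State) : IsProbabilityMeasure (σ.law s) := by
  unfold law; infer_instance

lemma lintegral_law_zero (s : State) {f : Slot → ℝ≥0∞} (hf : Measurable f) :
    ∫⁻ ω, f (ω 0) ∂σ.law s =
      ∫⁻ c, ∫⁻ a, f ((s, c), a) ∂σ.act 0 (Fin.elim0, (s, c)) ∂m.C := by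
  have hη : Measurable fun η : Finset.Iic 0 → Slot => f (η ⟨0, Finset.mem_Iic.2 le_rfl⟩) :=
    hf.comp (measurable_pi_apply _)
  have h := congrArg (fun μ => ∫⁻ η, f (η ⟨0, Finset.mem_Iic.2 le_rfl⟩) ∂μ)
    (σ.map_frestrictLe_zero_law s)
  beta_reduce at h
  rw [lintegral_map hη (Preorder.measurable_frestrictLe 0),
    lintegral_map hη (MeasurableEquiv.measurable _)] at h
  rw [← lintegral_initial σ s hf]
  exact h

lemma lintegral_law_succ (s : State) (n : ℕ) {f : Slot → ℝ≥0∞} (hf : Measurable f) :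
    ∫⁻ ω, f (ω (n + 1)) ∂σ.law s =
      ∫⁻ ω, ∫⁻ s', ∫⁻ c, ∫⁻ a, f ((s', c), a)
        ∂σ.act (n + 1) (toTuple n (Preorder.frestrictLe n ω), (s', c)) ∂m.C
        ∂m.transition ((ω n).1.1, (ω n).2) ∂σ.law s := by
  have h := Kernel.map_frestrictLe_trajMeasure_compProd_eq_map_trajMeasure
    (X := fun _ => Slot) (μ₀ := σ.initial s) (κ := σ.step) (a := n)
  have hf' : Measurable fun p : (Finset.Iic n → Slot) × Slot => f p.2 := hf.comp measurable_snd
  have h2 := congrArg (fun μ => ∫⁻ p, f p.2 ∂μ) h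
  beta_reduce at h2
  rw [Measure.lintegral_compProd hf', lintegral_map (Measurable.lintegral_kernel_prod_right' hf')
      (Preorder.measurable_frestrictLe n), lintegral_map hf' (by fun_prop)] at h2
  refine h2.symm.trans (lintegral_congr fun ω => ?_)
  exact lintegral_step σ n _ hf

end Strategy

/-! ### The state constraints are invariant -/

lemma iidMultiset_support (K : PMF ℕ) (j : ℕ) {N : Multiset ℕ}
    (h : N ∈ (iidMultiset K j).support) : N.card = j ∧ ∀ z ∈ N, z ∈ K.support := by
  induction j generalizing N with
  | zero =>
    rw [iidMultiset, PMF.support_pure, Set.mem_singleton_iff] at h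
    simp [h]
  | succ j ih =>
    rw [iidMultiset, PMF.mem_support_bind_iff] at h
    obtain ⟨k, hk, h⟩ := h
    rw [PMF.mem_support_map_iff] at h
    obtain ⟨Z, hZ, rfl⟩ := h
    obtain ⟨h1, h2⟩ := ih hZ
    refine ⟨by rw [Multiset.card_cons, h1], fun z hz => ?_⟩
    rcases Multiset.mem_cons.1 hz with rfl | hz
    · exact hk
    · exact h2 z hz

namespace Model

variable {m : Model}

lemma newContents_support {N : Multiset ℕ} (h : N ∈ m.newContents.support) :
    N.card ≤ m.Mmax ∧ ∀ z ∈ N, 1 ≤ z ∧ z ≤ m.Kmax := by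
  rw [newContents, PMF.mem_support_bind_iff] at h
  obtain ⟨j, hj, h⟩ := h
  obtain ⟨h1, h2⟩ := iidMultiset_support _ _ h
  exact ⟨h1 ▸ m.M_le j hj, fun z hz => m.K_mem z (h2 z hz)⟩

lemma ae_arrivalLaw (e : ℕ) :
    ∀ᵐ p ∂m.arrivalLaw e, p.1.card ≤ m.Mmax ∧ ∀ z ∈ p.1, 1 ≤ z ∧ z ≤ m.Kmax := by
  rw [ae_iff, arrivalLaw, PMF.toMeasure_apply_eq_zero_iff _ (MeasurableSet.of_discrete),
    Set.disjoint_left]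
  intro p hp hp'
  refine hp' ?_
  rw [arrivals, PMF.mem_support_bind_iff] at hp
  obtain ⟨N, hN, hp⟩ := hp
  rw [PMF.mem_support_map_iff] at hp
  obtain ⟨e', _, rfl⟩ := hp
  exact newContents_support hN

lemma countP_new_le {N : Multiset ℕ} (hc : N.card ≤ m.Mmax) (hN : ∀ z ∈ N, 1 ≤ z ∧ z ≤ m.Kmax)
    {k : ℕ} : N.countP (k ≤ ·) ≤ m.Mmax * (m.Kmax + 1 - k) - m.Mmax * (m.Kmax - k) := by
  rcases le_or_gt k m.Kmax with hk | hk
  · rw [Nat.succ_sub hk, Nat.mul_succ, Nat.add_sub_cancel_left]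
    exact (Multiset.countP_le_card _ _).trans hc
  · rw [Multiset.countP_eq_zero.2 fun z hz => by have := (hN z hz).2; omega]
    exact Nat.zero_le _

lemma countP_age_le {s : State} (hv : m.Valid s) (k : ℕ) :
    (age (s.out + s.cache)).countP (k ≤ ·) ≤ m.Mmax * (m.Kmax - k) := by
  have h : ∀ k, rank (age (s.out + s.cache)) k ≤ m.Mmax * (m.Kmax - (k + 1)) := fun k => by
    rw [rank_age]
    refine (hv.count (k + 2)).trans_eq ?_
    congr 1
    omega
  rcases k with _ | k
  · have h0 : rank (age (s.out + s.cache)) 0 = (age (s.out + s.cache)).countP (0 ≤ ·) := by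
      rw [rank_zero_eq_card fun z hz => by obtain ⟨y, _, hy, rfl⟩ := age_mem hz; omega]
      exact (Multiset.countP_eq_card.2 fun _ _ => Nat.zero_le _).symm
    rw [← h0]
    exact (h 0).trans (Nat.mul_le_mul_left _ (Nat.sub_le_sub_left (Nat.zero_le _) _))
  · exact h k

lemma Valid.nextState {s : State} {a : Action} (hv : m.Valid s) (ha : m.Feasible s a)
    {N : Multiset ℕ} (hc : N.card ≤ m.Mmax) (hN : ∀ z ∈ N, 1 ≤ z ∧ z ≤ m.Kmax) (e : ℕ) :
    m.Valid (nextState s a N e) := by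
  unfold ProactiveCaching.nextState
  unfold Feasible at ha
  split_ifs with he
  · refine ⟨by simpa using hN, fun k => ?_, by simp⟩
    rw [add_zero]
    exact (countP_new_le hc hN).trans (Nat.sub_le _ _)
  · rw [if_neg he] at ha
    obtain ⟨hA, hD, hB⟩ := ha
    have hX : age (s.out + a.discard - a.download) + N + age (s.cache + a.download - a.discard) =
        age (s.out + s.cache) + N := by
      rw [add_right_comm, ← age_add, out_add_cache_action hA hD]
    refine ⟨fun z hz => ?_, fun k => ?_, ?_⟩
    · rw [hX] at hz
      rcases Multiset.mem_add.1 hz with hz | hz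
      · obtain ⟨y, hy, h1, rfl⟩ := age_mem hz
        have := (hv.lifetime y hy).2
        omega
      · exact hN z hz
    · rw [hX, Multiset.countP_add]
      have h1 := countP_age_le hv k
      have h2 := countP_new_le hc hN (k := k)
      have h3 : m.Mmax * (m.Kmax - k) ≤ m.Mmax * (m.Kmax + 1 - k) :=
        Nat.mul_le_mul_left _ (by omega)
      omega
    · refine le_trans ?_ hB
      change (age _).card ≤ _
      rw [age, Multiset.card_map]
      exact Multiset.card_le_card (Multiset.filter_le _ _)

lemma ae_transition_valid {s : State} {a : Action} (hv : m.Valid s) (ha : m.Feasible s a) :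
    ∀ᵐ s' ∂m.transition (s, a), m.Valid s' := by
  rw [transition_eq_map, ae_map_iff Measurable.of_discrete.aemeasurable
    (MeasurableSet.of_discrete)]
  filter_upwards [m.ae_arrivalLaw s.elapsed] with p hp
  exact hv.nextState ha hp.1 hp.2 p.2

lemma Valid.card_le {s : State} (hv : m.Valid s) : (s.out + s.cache).card ≤ m.maxContents := by
  have h := hv.count 1
  rwa [Multiset.countP_eq_card.2 fun z hz => (hv.lifetime z hz).1, Nat.add_sub_cancel] at h

/-! ### The optimality equation for the states of the model -/

/-- The reduced state that corresponds to a state. -/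
def reduce (s : State) : Reduced := ⟨s.out + s.cache, rank s.cache, s.elapsed⟩

/-- The cache after an action, before the contents age. -/
def cacheAfter (s : State) (a : Action) : Multiset ℕ := s.cache + a.download - a.discard

lemma reduce_nextState {s : State} {a : Action} (he : s.elapsed ≠ 0) (ha : m.Feasible s a)
    (N : Multiset ℕ) (e : ℕ) : reduce (nextState s a N e) =
      ⟨age (s.out + s.cache) + N, fun k => rank (cacheAfter s a) (k + 1), e⟩ := by
  rw [Feasible, if_neg he] at ha
  rw [nextState, if_neg he]
  have hX : age (s.out + a.discard - a.download) + N + age (s.cache + a.download - a.discard) =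
      age (s.out + s.cache) + N := by
    rw [add_right_comm, ← age_add, out_add_cache_action ha.1 ha.2.1]
  simp only [reduce, hX, cacheAfter, ← rank_age]

variable {g R : ℝ} {h : Reduced → ℝ}

/-- The relative value of a state, shifted to be nonnegative. -/
def stateValue (h : Reduced → ℝ) (R : ℝ) (s : State) : ℝ≥0∞ := ENNReal.ofReal (h (reduce s) + R)

lemma stateValue_le (hR : ∀ z, |h z| ≤ R) (s : State) :
    stateValue h R s ≤ ENNReal.ofReal (2 * R) :=
  ENNReal.ofReal_le_ofReal (by have := (abs_le.1 (hR (reduce s))).2; linarith)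

lemma lintegral_stateValue_transition (hR : ∀ z, |h z| ≤ R) {s : State} {a : Action}
    (he : s.elapsed ≠ 0) (ha : m.Feasible s a) :
    ∫⁻ x, stateValue h R x ∂m.transition (s, a) = ENNReal.ofReal
      (m.continuation h (s.out + s.cache) s.elapsed (rank (cacheAfter s a)) + R) := by
  have hi := integrable_continuation (m := m) ⟨R, hR⟩ (s.out + s.cache) s.elapsed
    (rank (cacheAfter s a))
  have hi' : Integrable (fun p : Multiset ℕ × ℕ => h ⟨age (s.out + s.cache) + p.1,
      fun k => rank (cacheAfter s a) (k + 1), p.2⟩ + R) (m.arrivalLaw s.elapsed) :=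
    hi.add (integrable_const _)
  have h1 : m.continuation h (s.out + s.cache) s.elapsed (rank (cacheAfter s a)) + R =
      ∫ p, (h ⟨age (s.out + s.cache) + p.1, fun k => rank (cacheAfter s a) (k + 1), p.2⟩ + R)
        ∂m.arrivalLaw s.elapsed := by
    rw [integral_add hi (integrable_const _)]
    simp [continuation]
  rw [lintegral_transition, h1, ofReal_integral_eq_lintegral_ofReal hi'
    (Eventually.of_forall fun p => by
      have := (abs_le.1 (hR ⟨age (s.out + s.cache) + p.1,
        fun k => rank (cacheAfter s a) (k + 1), p.2⟩)).1
      simp only [Pi.zero_apply]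
      linarith)]
  simp only [stateValue, reduce_nextState he ha]

lemma lintegral_stateValue_transition_access (hs : m.IsSolution g h) (hR : ∀ z, |h z| ≤ R)
    {s : State} (a : Action) (he : s.elapsed = 0) :
    ∫⁻ x, stateValue h R x ∂m.transition (s, a) = ENNReal.ofReal R := by
  have hi : Integrable (fun p : Multiset ℕ × ℕ => h ⟨p.1, 0, p.2⟩) (m.arrivalLaw 0) :=
    Integrable.of_bound Measurable.of_discrete.aestronglyMeasurable R
      (Eventually.of_forall fun p => hR _)
  have hi' : Integrable (fun p : Multiset ℕ × ℕ => h ⟨p.1, 0, p.2⟩ + R) (m.arrivalLaw 0) :=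
    hi.add (integrable_const _)
  have h1 : R = ∫ p : Multiset ℕ × ℕ, (h ⟨p.1, 0, p.2⟩ + R) ∂m.arrivalLaw 0 := by
    rw [integral_add hi (integrable_const _), hs.normalized]
    simp
  have h0 : (rank 0 : ℕ → ℕ) = 0 := by funext k; simp [rank]
  rw [lintegral_transition, he]
  conv_rhs => rw [h1]
  rw [ofReal_integral_eq_lintegral_ofReal hi'
    (Eventually.of_forall fun p => by
      have := (abs_le.1 (hR ⟨p.1, 0, p.2⟩)).1
      simp only [Pi.zero_apply]
      linarith)]
  simp only [stateValue, nextState, if_pos he, reduce, h0, add_zero]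

variable (m) in
/-- The optimal expected value of a slot with observed channel cost `c`: its cost plus the relative
value of the next state, shifted by `R`. -/
def costToGo (h : Reduced → ℝ) (R : ℝ) (s : State) (c : ℝ) : ℝ :=
  if s.elapsed = 0 then c * s.out.card + R
  else m.slotValue h (s.out + s.cache) s.elapsed (rank s.cache) c + R

lemma costToGo_nonneg (hR : ∀ z, |h z| ≤ R) (s : State) {c : ℝ} (hc : 0 < c) :
    0 ≤ m.costToGo h R s c := by
  have hR0 : 0 ≤ R := (abs_nonneg _).trans (hR ⟨0, 0, 0⟩)
  unfold costToGo
  split_ifs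
  · positivity
  · obtain ⟨a, -, ha⟩ := inf'_range_exists m.B fun a => c * a + m.continuation h
      (s.out + s.cache) s.elapsed (fillTo (m.bound (s.out + s.cache)) (rank s.cache) a)
    rw [slotValue, ha]
    have h1 := (abs_le.1 (abs_continuation_le (m := m) hR (s.out + s.cache) s.elapsed
      (fillTo (m.bound (s.out + s.cache)) (rank s.cache) a))).1
    have h2 : 0 ≤ c * a := by positivity
    linarith

/-- The optimality equation at a state of the model.  Here the truncation of the number of contents
in the relaxed Bellman operator has no effect. -/
lemma lintegral_costToGo (hs : m.IsSolution g h) (hR : ∀ z, |h z| ≤ R) {s : State}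
    (hv : m.Valid s) :
    ∫⁻ c, ENNReal.ofReal (m.costToGo h R s c) ∂m.C = ENNReal.ofReal g + stateValue h R s := by
  have hfix := congrFun hs.fixed (reduce s)
  have hi : Integrable (m.costToGo h R s) m.C := by
    unfold costToGo
    split_ifs
    · exact (m.integrable_cost.mul_const _).add (integrable_const _)
    · exact (integrable_slotValue ⟨R, hR⟩ _ _ _).add (integrable_const _)
  rw [← ofReal_integral_eq_lintegral_ofReal hi (by
    filter_upwards [m.C_mem] with c hc using costToGo_nonneg hR s hc.1), stateValue,
    ← ENNReal.ofReal_add hs.nonneg (by have := (abs_le.1 (hR (reduce s))).1; linarith)]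
  congr 1
  rw [← hfix, bellman]
  unfold costToGo
  by_cases he : s.elapsed = 0
  · have h1 : min (reduce s).contents.card m.maxContents - (reduce s).fill 0 = s.out.card := by
      change min (s.out + s.cache).card m.maxContents - rank s.cache 0 = s.out.card
      rw [min_eq_left hv.card_le, rank_zero_eq_card fun z hz =>
        (hv.lifetime z (Multiset.mem_add.2 (Or.inr hz))).1, Multiset.card_add,
        Nat.add_sub_cancel]
    rw [if_pos (show (reduce s).elapsed = 0 from he), h1]
    simp only [if_pos he]
    rw [integral_add (m.integrable_cost.mul_const _) (integrable_const _), integral_mul_const]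
    simp only [meanCost, integral_const, probReal_univ, one_smul]
    ring
  · rw [if_neg (show (reduce s).elapsed ≠ 0 from he)]
    simp only [if_neg he]
    rw [integral_add (integrable_slotValue ⟨R, hR⟩ _ _ _) (integrable_const _)]
    simp only [reduce, integral_const, probReal_univ, one_smul]
    ring

/-- No feasible action is better than the minimum in the relaxed optimality equation, since
`a` downloads raise the rank function of the cache by at most `a`. -/
lemma costToGo_le (hs : m.IsSolution g h) (hR : ∀ z, |h z| ≤ R) {s : State} {a : Action} {c : ℝ}
    (hc : 0 < c) (ha : m.Feasible s a) :
    ENNReal.ofReal (m.costToGo h R s c) ≤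
      slotCost ((s, c), a) + ∫⁻ x, stateValue h R x ∂m.transition (s, a) := by
  have hR0 : 0 ≤ R := (abs_nonneg _).trans (hR ⟨0, 0, 0⟩)
  have hcost : slotCost ((s, c), a) = ENNReal.ofReal (c * a.download.card) := by
    rw [slotCost, mul_comm c, ENNReal.ofReal_mul (Nat.cast_nonneg _), ENNReal.ofReal_natCast]
  rw [hcost]
  by_cases he : s.elapsed = 0
  · rw [lintegral_stateValue_transition_access hs hR a he,
      ← ENNReal.ofReal_add (by positivity) hR0, costToGo, if_pos he]
    rw [Feasible, if_pos he] at ha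
    rw [ha.1]
  · rw [lintegral_stateValue_transition hR he ha, costToGo, if_neg he]
    have ha' := ha
    rw [Feasible, if_neg he] at ha'
    obtain ⟨hA, hD, hB⟩ := ha'
    have hle := (abs_le.1 (abs_continuation_le (m := m) hR (s.out + s.cache) s.elapsed
      (rank (cacheAfter s a)))).1
    rw [← ENNReal.ofReal_add (by positivity) (by linarith), ← add_assoc]
    refine ENNReal.ofReal_le_ofReal (add_le_add_left ?_ R)
    have hcard : a.download.card ≤ m.B := by
      have h1 : a.download ≤ s.cache + a.download - a.discard := by
        rw [add_comm, Multiset.add_sub_assoc hD]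
        exact Multiset.le_add_right _ _
      exact (Multiset.card_le_card h1).trans hB
    refine (inf'_range_le _ hcard).trans ?_
    refine add_le_add_right ?_ _
    refine hs.regular.continuation_antitone hs.bounded _ _ fun k => ?_
    have h1 := rank_action (A := a.download) hD k
    have h2 : rank (cacheAfter s a) k ≤ m.B := (rank_le_card _ _).trans hB
    have h3 := rank_mono hA k
    have h4 := rank_mono hD k
    have h5 := rank_le_card a.download k
    simp only [fillTo, bound, rank_add, cacheAfter] at h1 h2 ⊢
    omega

end Model

/-! ### The threshold policy -/

namespace Model

variable (m : Model)

/-- The decrease of the expected future cost by the swap number `i`, clipped to `[0, Cmax]`. -/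
def threshold (h : Reduced → ℝ) (s : State) (i : ℕ) : ℝ :=
  max 0 (min m.Cmax
    (m.continuation h (s.out + s.cache) s.elapsed
        (fillTo (m.bound (s.out + s.cache)) (rank s.cache) i) -
      m.continuation h (s.out + s.cache) s.elapsed
        (fillTo (m.bound (s.out + s.cache)) (rank s.cache) (i + 1))))

open Classical in
/-- The policy that performs the swaps whose threshold is at least the channel cost.  In states
that violate the constraints, the cache is emptied. -/
def thresholdPolicy (h : Reduced → ℝ) : Policy m where
  act s c := if s.elapsed = 0 then ⟨s.out, s.cache⟩
    else if m.Valid s then swaps m s {i | c ≤ m.threshold h s i}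
    else ⟨0, s.cache⟩
  measurable s := by
    split_ifs
    · exact measurable_const
    · have h1 : Measurable fun (c : ℝ) (i : Fin m.B) => c ≤ m.threshold h s i :=
        measurable_pi_lambda _ fun i => measurableSet_setOfPred.1 measurableSet_Iic
      have h2 : Measurable fun P : Fin m.B → Prop => swaps m s (Finset.univ.filter P) :=
        measurable_of_finite _
      convert h2.comp h1
      simp only [Function.comp_apply]
    · exact measurable_const
  feasible s c := by
    split_ifs with h0 hv
    · simp [Feasible, h0]
    · exact feasible_swaps hv h0 _
    · simp [Feasible, h0]

variable {m} {g R : ℝ} {h : Reduced → ℝ}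

lemma threshold_anti (hs : m.IsSolution g h) (s : State) : Antitone (m.threshold h s) := by
  refine antitone_nat_of_succ_le fun i => ?_
  have h1 := (hs.regular.continuation_lnatural hs.bounded (m := m) (s.out + s.cache)
    s.elapsed).convex_fillTo (hs.regular.continuation_antitone hs.bounded _ _)
    (m.bound (s.out + s.cache)) (rank s.cache) i
  exact max_le_max_left _ (min_le_min_left _ (by linarith))

/-- An antitone family of thresholds selects an initial segment of swaps. -/
lemma exists_initial_segment {T : ℕ → ℝ} (hT : Antitone T) (B : ℕ) (c : ℝ) :
    ∃ j ≤ B, (∀ i < j, c ≤ T i) ∧ ∀ i, j ≤ i → i < B → T i < c := by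
  have hex : ∃ j, ∀ i, j ≤ i → i < B → T i < c := ⟨B, fun i h1 h2 => absurd h2 h1.not_gt⟩
  classical
  refine ⟨Nat.find hex, Nat.find_min' hex fun i h1 h2 => absurd h2 h1.not_gt, fun i hi => ?_,
    Nat.find_spec hex⟩
  by_contra hc
  exact Nat.find_min hex hi fun k hk _ => (hT hk).trans_lt (not_le.1 hc)

lemma thresholdPolicy_act {s : State} (hv : m.Valid s) (he : s.elapsed ≠ 0) (c : ℝ) :
    (m.thresholdPolicy h).act s c = swaps m s {i | c ≤ m.threshold h s i} := by
  simp only [thresholdPolicy, if_neg he, if_pos hv]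

/-- The threshold policy attains the minimum in the optimality equation. -/
lemma thresholdPolicy_attains (hs : m.IsSolution g h) (hR : ∀ z, |h z| ≤ R) {s : State}
    (hv : m.Valid s) {c : ℝ} (hc : 0 < c) (hcmax : c ≤ m.Cmax) :
    slotCost ((s, c), (m.thresholdPolicy h).act s c) +
      ∫⁻ x, stateValue h R x ∂m.transition (s, (m.thresholdPolicy h).act s c) ≤
    ENNReal.ofReal (m.costToGo h R s c) := by
  have hR0 : 0 ≤ R := (abs_nonneg _).trans (hR ⟨0, 0, 0⟩)
  have hcost : ∀ a, slotCost ((s, c), a) = ENNReal.ofReal (c * a.download.card) := fun a => by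
    rw [slotCost, mul_comm c, ENNReal.ofReal_mul (Nat.cast_nonneg _), ENNReal.ofReal_natCast]
  have hfeas := (m.thresholdPolicy h).feasible s c
  rw [hcost]
  by_cases he : s.elapsed = 0
  · rw [lintegral_stateValue_transition_access hs hR _ he,
      ← ENNReal.ofReal_add (by positivity) hR0, costToGo, if_pos he]
    rw [Feasible, if_pos he] at hfeas
    rw [hfeas.1]
  · rw [lintegral_stateValue_transition hR he hfeas]
    obtain ⟨j, hjB, hlt, hge⟩ := exists_initial_segment (threshold_anti hs s) m.B c
    have hact : (m.thresholdPolicy h).act s c = firstSwaps m s j := by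
      rw [thresholdPolicy_act hv he, firstSwaps]
      congr 1
      ext i
      simp only [Finset.mem_filter, Finset.mem_univ, true_and]
      exact ⟨fun hi => lt_of_not_ge fun hji => (hge i hji i.2).not_ge hi, hlt i⟩
    set w : ℕ → ℝ := fun a => m.continuation h (s.out + s.cache) s.elapsed
      (fillTo (m.bound (s.out + s.cache)) (rank s.cache) a) with hw
    have hthr : ∀ i, m.threshold h s i = max 0 (min m.Cmax (w i - w (i + 1))) := fun _ => rfl
    have hdec : ∀ i < j, c ≤ w i - w (i + 1) := fun i hi => by
      have h1 := hlt i hi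
      rw [hthr, le_max_iff, le_min_iff] at h1
      exact (h1.resolve_left hc.not_ge).2
    have hinc : ∀ i, j ≤ i → i < m.B → w i - w (i + 1) < c := fun i h1 h2 => by
      have h3 := hge i h1 h2
      rw [hthr, max_lt_iff, min_lt_iff] at h3
      exact h3.2.resolve_left hcmax.not_gt
    -- a swap with positive threshold is effective: it puts a content of larger lifetime
    -- into the cache
    have hk : ∃ k, rank s.cache k + j ≤ m.bound (s.out + s.cache) k := by
      rcases j with _ | i
      · refine ⟨0, le_min ((rank_le_card _ _).trans hv.capacity) ?_⟩
        rw [rank_add]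
        omega
      · by_contra! hcon
        have h1 : fillTo (m.bound (s.out + s.cache)) (rank s.cache) i =
            fillTo (m.bound (s.out + s.cache)) (rank s.cache) (i + 1) := by
          funext k
          have := hcon k
          simp only [fillTo]
          omega
        have h2 := hdec i (Nat.lt_succ_self i)
        simp only [hw, h1, sub_self] at h2
        exact hc.not_ge h2
    obtain ⟨hrank, hcard⟩ := firstSwaps_spec hv hjB hk
    have hleft : ∀ d, d ≤ j → c * j + w j ≤ c * ((j - d : ℕ) : ℝ) + w (j - d) := by
      intro d
      induction d with
      | zero => intro _; exact le_rfl
      | succ d ih =>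
        intro hd
        obtain ⟨i, hi⟩ := Nat.exists_eq_add_of_le hd
        have h1 := ih (by omega)
        have e1 : j - d = i + 1 := by omega
        have e2 : j - (d + 1) = i := by omega
        rw [e1] at h1
        rw [e2]
        have h2 := hdec i (by omega)
        push_cast at h1
        linarith
    have hright : ∀ d, j + d ≤ m.B → c * j + w j ≤ c * ((j + d : ℕ) : ℝ) + w (j + d) := by
      intro d
      induction d with
      | zero => intro _; exact le_rfl
      | succ d ih =>
        intro hd
        have h1 := ih (by omega)
        have h2 := hinc (j + d) (by omega) (by omega)
        rw [← add_assoc]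
        push_cast at h1 ⊢
        linarith
    rw [hact, cacheAfter, hrank, hcard]
    have hle := (abs_le.1 (abs_continuation_le (m := m) hR (s.out + s.cache) s.elapsed
      (fillTo (m.bound (s.out + s.cache)) (rank s.cache) j))).1
    rw [← ENNReal.ofReal_add (by positivity) (by linarith), ← add_assoc, costToGo, if_neg he]
    refine ENNReal.ofReal_le_ofReal (add_le_add_left (Finset.le_inf' _ _ fun a ha => ?_) R)
    rw [Finset.mem_range] at ha
    rcases le_total a j with haj | haj
    · have := hleft (j - a) (Nat.sub_le _ _)
      rwa [Nat.sub_sub_self haj] at this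
    · have := hright (a - j) (by omega)
      rwa [Nat.add_sub_cancel' haj] at this

end Model

/-! ### Verification -/

section Verification

variable {m : Model} {g R : ℝ} {h : Reduced → ℝ}

lemma measurable_slotCost : Measurable slotCost := by
  have h1 : Measurable fun a : Action => (a.download.card : ℝ≥0∞) := Measurable.of_discrete
  exact (h1.comp measurable_snd).mul
    (ENNReal.measurable_ofReal.comp (measurable_snd.comp measurable_fst))

lemma measurable_state_action : Measurable fun x : Slot => (x.1.1, x.2) :=
  (measurable_fst.comp measurable_fst).prodMk measurable_snd

variable (m) in
/-- The expected relative value of the state that follows a slot. -/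
def nextValue (h : Reduced → ℝ) (R : ℝ) (x : Slot) : ℝ≥0∞ :=
  ∫⁻ y, Model.stateValue h R y ∂m.transition (x.1.1, x.2)

lemma measurable_nextValue : Measurable (nextValue m h R) :=
  (Measurable.of_discrete (f := fun p : State × Action =>
    ∫⁻ y, Model.stateValue h R y ∂m.transition p)).comp measurable_state_action

lemma nextValue_le (hR : ∀ z, |h z| ≤ R) (x : Slot) :
    nextValue m h R x ≤ ENNReal.ofReal (2 * R) :=
  (lintegral_mono fun y => Model.stateValue_le hR y).trans_eq (by simp)

/-- All slots of the controlled chain satisfy the constraints. -/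
lemma Strategy.ae_valid_feasible (σ : Strategy m) {s : State} (hv : m.Valid s) (n : ℕ) :
    ∀ᵐ ω ∂σ.law s, m.Valid (ω n).1.1 ∧ m.Feasible (ω n).1.1 (ω n).2 := by
  have hG : MeasurableSet {x : Slot | ¬ (m.Valid x.1.1 ∧ m.Feasible x.1.1 x.2)} :=
    measurable_state_action (MeasurableSet.of_discrete
      (s := {p : State × Action | ¬ (m.Valid p.1 ∧ m.Feasible p.1 p.2)}))
  set f : Slot → ℝ≥0∞ :=
    Set.indicator {x : Slot | ¬ (m.Valid x.1.1 ∧ m.Feasible x.1.1 x.2)} 1 with hf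
  have hfm : Measurable f := measurable_one.indicator hG
  -- in a valid state, a strategy almost surely takes feasible actions
  have hslot : ∀ {s : State} (_ : m.Valid s) (q : ℝ → Measure Action)
      (_ : ∀ c, ∀ᵐ a ∂q c, m.Feasible s a), ∫⁻ c, ∫⁻ a, f ((s, c), a) ∂q c ∂m.C = 0 := by
    intro s hv q hq
    refine (lintegral_congr fun c => ?_).trans lintegral_zero
    refine (lintegral_congr_ae ?_).trans lintegral_zero
    filter_upwards [hq c] with a ha
    exact Set.indicator_of_notMem
      (fun hn => absurd (⟨hv, ha⟩ : m.Valid s ∧ m.Feasible s a) hn) _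
  have hzero : ∀ n, ∫⁻ ω, f (ω n) ∂σ.law s = 0 →
      ∀ᵐ ω ∂σ.law s, m.Valid (ω n).1.1 ∧ m.Feasible (ω n).1.1 (ω n).2 := by
    intro n h0
    have hfn : Measurable fun ω : ℕ → Slot => f (ω n) := hfm.comp (measurable_pi_apply n)
    rw [lintegral_eq_zero_iff hfn] at h0
    filter_upwards [h0] with ω hω
    by_contra hn
    have h1 : f (ω n) = 1 := Set.indicator_of_mem (show ω n ∈ {x : Slot | _} from hn) _
    exact one_ne_zero (h1.symm.trans hω)
  induction n with
  | zero =>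
    refine hzero 0 ?_
    rw [σ.lintegral_law_zero s hfm]
    exact hslot hv _ fun c => σ.feasible 0 _ s c
  | succ n ih =>
    refine hzero (n + 1) ?_
    rw [σ.lintegral_law_succ s n hfm]
    refine (lintegral_congr_ae ?_).trans lintegral_zero
    filter_upwards [ih] with ω hω
    refine (lintegral_congr_ae ?_).trans lintegral_zero
    filter_upwards [Model.ae_transition_valid hω.1 hω.2] with s' hs'
    exact hslot hs' _ fun c => σ.feasible (n + 1) _ s' c

/-- The expected cost of a slot. -/
def Strategy.expectedCost (σ : Strategy m) (s : State) (n : ℕ) : ℝ≥0∞ :=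
  ∫⁻ ω, slotCost (ω n) ∂σ.law s

/-- The expected relative value of the state after a slot. -/
def Strategy.expectedNextValue (σ : Strategy m) (h : Reduced → ℝ) (R : ℝ) (s : State) (n : ℕ) :
    ℝ≥0∞ :=
  ∫⁻ ω, nextValue m h R (ω n) ∂σ.law s

lemma Strategy.expected_add (σ : Strategy m) (s : State) (n : ℕ) :
    σ.expectedCost s n + σ.expectedNextValue h R s n =
      ∫⁻ ω, (slotCost (ω n) + nextValue m h R (ω n)) ∂σ.law s :=
  (lintegral_add_right _ (measurable_nextValue.comp (measurable_pi_apply n))).symm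

lemma Strategy.expectedNextValue_le (σ : Strategy m) (hR : ∀ z, |h z| ≤ R) (s : State) (n : ℕ) :
    σ.expectedNextValue h R s n ≤ ENNReal.ofReal (2 * R) := by
  have h1 : σ.expectedNextValue h R s n ≤ ∫⁻ _, ENNReal.ofReal (2 * R) ∂σ.law s :=
    lintegral_mono fun ω => nextValue_le hR (ω n)
  rwa [lintegral_const, measure_univ, mul_one] at h1

lemma le_lintegral_slot (hs : m.IsSolution g h) (hR : ∀ z, |h z| ≤ R) {s : State}
    (hv : m.Valid s) (q : ℝ → Measure Action) [∀ c, IsProbabilityMeasure (q c)]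
    (hq : ∀ c, ∀ᵐ a ∂q c, m.Feasible s a) :
    ENNReal.ofReal g + Model.stateValue h R s ≤
      ∫⁻ c, ∫⁻ a, (slotCost ((s, c), a) + nextValue m h R ((s, c), a)) ∂q c ∂m.C := by
  rw [← Model.lintegral_costToGo hs hR hv]
  refine lintegral_mono_ae ?_
  filter_upwards [m.C_mem] with c hc
  calc ENNReal.ofReal (m.costToGo h R s c)
      = ∫⁻ _, ENNReal.ofReal (m.costToGo h R s c) ∂q c := by simp
    _ ≤ _ := by
      refine lintegral_mono_ae ?_
      filter_upwards [hq c] with a ha using Model.costToGo_le hs hR hc.1 ha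

lemma lintegral_slot_thresholdPolicy_le (hs : m.IsSolution g h) (hR : ∀ z, |h z| ≤ R) {s : State}
    (hv : m.Valid s) {n : ℕ} (η : Fin n → Slot) :
    ∫⁻ c, ∫⁻ a, (slotCost ((s, c), a) + nextValue m h R ((s, c), a))
        ∂(m.thresholdPolicy h).toStrategy.act n (η, (s, c)) ∂m.C ≤
      ENNReal.ofReal g + Model.stateValue h R s := by
  rw [← Model.lintegral_costToGo hs hR hv]
  refine lintegral_mono_ae ?_
  filter_upwards [m.C_mem] with c hc
  simp only [Policy.toStrategy]
  rw [Kernel.deterministic_apply, lintegral_dirac]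
  exact Model.thresholdPolicy_attains hs hR hv hc.1 hc.2

lemma measurable_slotCost_add_nextValue :
    Measurable fun x : Slot => slotCost x + nextValue m h R x :=
  measurable_slotCost.add measurable_nextValue

/-- For every strategy, the expected cost of `T + 1` slots is at least `g * (T + 1)`, up to the
relative values of the initial and the final state. -/
lemma Strategy.le_sum_expectedCost (σ : Strategy m) (hs : m.IsSolution g h)
    (hR : ∀ z, |h z| ≤ R) {s : State} (hv : m.Valid s) (T : ℕ) :
    ENNReal.ofReal g * ((T + 1 : ℕ) : ℝ≥0∞) + Model.stateValue h R s ≤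
      ∑ t ∈ Finset.range (T + 1), σ.expectedCost s t + σ.expectedNextValue h R s T := by
  induction T with
  | zero =>
    rw [zero_add, Nat.cast_one, mul_one, Finset.sum_range_one, σ.expected_add,
      σ.lintegral_law_zero s measurable_slotCost_add_nextValue]
    exact le_lintegral_slot hs hR hv _ fun c => σ.feasible 0 _ s c
  | succ T ih =>
    have h1 : ENNReal.ofReal g + σ.expectedNextValue h R s T ≤
        σ.expectedCost s (T + 1) + σ.expectedNextValue h R s (T + 1) := by
      rw [σ.expected_add, σ.lintegral_law_succ s T measurable_slotCost_add_nextValue]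
      calc _ = ∫⁻ ω, (ENNReal.ofReal g + nextValue m h R (ω T)) ∂σ.law s := by
            rw [lintegral_add_left measurable_const, expectedNextValue]
            simp
        _ ≤ _ := by
            refine lintegral_mono_ae ?_
            filter_upwards [σ.ae_valid_feasible hv T] with ω hω
            calc _ = ∫⁻ y, (ENNReal.ofReal g + Model.stateValue h R y)
                  ∂m.transition ((ω T).1.1, (ω T).2) := by
                  rw [lintegral_add_left measurable_const, nextValue]
                  simp
              _ ≤ _ := by
                  refine lintegral_mono_ae ?_
                  filter_upwards [Model.ae_transition_valid hω.1 hω.2] with s' hs'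
                  exact le_lintegral_slot hs hR hs' _ fun c => σ.feasible (T + 1) _ s' c
    rw [Finset.sum_range_succ _ (T + 1),
      add_assoc (∑ t ∈ Finset.range (T + 1), σ.expectedCost s t)]
    refine le_trans ?_ (add_le_add_right h1 _)
    rw [Nat.cast_succ (T + 1), mul_add, mul_one, add_right_comm]
    exact (add_le_add_left ih _).trans_eq (by ring)

/-- For the threshold policy, the lower bound on the expected cost is attained. -/
lemma sum_expectedCost_thresholdPolicy_le (hs : m.IsSolution g h)
    (hR : ∀ z, |h z| ≤ R) {s : State} (hv : m.Valid s) (T : ℕ) :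
    ∑ t ∈ Finset.range (T + 1), (m.thresholdPolicy h).toStrategy.expectedCost s t +
        (m.thresholdPolicy h).toStrategy.expectedNextValue h R s T ≤
      ENNReal.ofReal g * ((T + 1 : ℕ) : ℝ≥0∞) + Model.stateValue h R s := by
  set σ := (m.thresholdPolicy h).toStrategy with hσ
  induction T with
  | zero =>
    rw [zero_add, Nat.cast_one, mul_one, Finset.sum_range_one, σ.expected_add,
      σ.lintegral_law_zero s measurable_slotCost_add_nextValue]
    exact lintegral_slot_thresholdPolicy_le hs hR hv _
  | succ T ih =>
    have h1 : σ.expectedCost s (T + 1) + σ.expectedNextValue h R s (T + 1) ≤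
        ENNReal.ofReal g + σ.expectedNextValue h R s T := by
      rw [σ.expected_add, σ.lintegral_law_succ s T measurable_slotCost_add_nextValue]
      calc _ ≤ ∫⁻ ω, (ENNReal.ofReal g + nextValue m h R (ω T)) ∂σ.law s := by
            refine lintegral_mono_ae ?_
            filter_upwards [σ.ae_valid_feasible hv T] with ω hω
            calc _ ≤ ∫⁻ y, (ENNReal.ofReal g + Model.stateValue h R y)
                  ∂m.transition ((ω T).1.1, (ω T).2) := by
                  refine lintegral_mono_ae ?_
                  filter_upwards [Model.ae_transition_valid hω.1 hω.2] with s' hs'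
                  exact lintegral_slot_thresholdPolicy_le hs hR hs' _
              _ = _ := by
                  rw [lintegral_add_left measurable_const, nextValue]
                  simp
        _ = _ := by
            rw [lintegral_add_left measurable_const, Strategy.expectedNextValue]
            simp
    rw [Finset.sum_range_succ _ (T + 1),
      add_assoc (∑ t ∈ Finset.range (T + 1), σ.expectedCost s t)]
    refine (add_le_add_right h1 _).trans ?_
    rw [Nat.cast_succ (T + 1), mul_add, mul_one, add_right_comm]
    exact le_trans (by rw [add_left_comm, add_comm]) (add_le_add_left ih _)

lemma tendsto_const_div_atTop {K : ℝ≥0∞} (hK : K ≠ ⊤) :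
    Tendsto (fun T : ℕ => K / T) atTop (nhds 0) := by
  have := ENNReal.Tendsto.const_div (a := K) ENNReal.tendsto_nat_nhds_top (Or.inr hK)
  rwa [ENNReal.div_top] at this

lemma le_limsup_div_of_mul_le {A : ℕ → ℝ≥0∞} {γ K : ℝ≥0∞} (hK : K ≠ ⊤)
    (hA : ∀ T, γ * T ≤ A T + K) : γ ≤ limsup (fun T : ℕ => A T / T) atTop := by
  refine ENNReal.le_of_forall_pos_le_add fun ε hε _ => ?_
  rw [← tsub_le_iff_right]
  refine le_limsup_of_frequently_le (Eventually.frequently ?_)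
  filter_upwards [(tendsto_const_div_atTop hK).eventually_le_const
    (ENNReal.coe_pos.2 hε), eventually_gt_atTop 0] with T h1 h2
  have hT : (T : ℝ≥0∞) ≠ 0 := by exact_mod_cast h2.ne'
  rw [tsub_le_iff_right]
  calc γ ≤ (A T + K) / T := by
        rw [ENNReal.le_div_iff_mul_le (Or.inl hT) (Or.inl (ENNReal.natCast_ne_top T))]
        exact hA T
    _ = A T / T + K / T := ENNReal.add_div
    _ ≤ A T / T + ε := add_le_add_right h1 _

lemma limsup_div_le_of_le_mul {A : ℕ → ℝ≥0∞} {γ K : ℝ≥0∞} (hK : K ≠ ⊤)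
    (hA : ∀ T, A T ≤ γ * T + K) : limsup (fun T : ℕ => A T / T) atTop ≤ γ := by
  refine ENNReal.le_of_forall_pos_le_add fun ε hε _ => ?_
  refine limsup_le_of_le (h := ?_)
  filter_upwards [(tendsto_const_div_atTop hK).eventually_le_const
    (ENNReal.coe_pos.2 hε), eventually_gt_atTop 0] with T h1 h2
  have hT : (T : ℝ≥0∞) ≠ 0 := by exact_mod_cast h2.ne'
  calc A T / T ≤ (γ * T + K) / T := ENNReal.div_le_div_right (hA T) _
    _ = γ + K / T := by
        rw [ENNReal.add_div, ENNReal.mul_div_cancel_right hT (ENNReal.natCast_ne_top T)]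
    _ ≤ γ + ε := add_le_add_right h1 _

lemma Strategy.averageCost_eq (σ : Strategy m) (s : State) : σ.averageCost s =
    limsup (fun T : ℕ => (∑ t ∈ Finset.range T, σ.expectedCost s t) / T) atTop := by
  unfold averageCost expectedCost
  refine congrArg (fun f => limsup f atTop) (funext fun T => ?_)
  rw [lintegral_finsetSum _ fun t _ => show Measurable fun ω : ℕ → Slot => slotCost (ω t) from
    measurable_slotCost.comp (measurable_pi_apply t)]

theorem isOptimal_thresholdPolicy (hs : m.IsSolution g h) : (m.thresholdPolicy h).IsOptimal := by
  intro s hst σ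
  obtain ⟨R, hR⟩ := hs.bounded
  have hv := hst.valid
  have hK : ENNReal.ofReal (2 * R) ≠ ⊤ := ENNReal.ofReal_ne_top
  refine le_trans (b := ENNReal.ofReal g) ?_ ?_
  · rw [Strategy.averageCost_eq]
    refine limsup_div_le_of_le_mul hK fun T => ?_
    rcases T with _ | T
    · simp
    · exact le_self_add.trans ((sum_expectedCost_thresholdPolicy_le hs hR hv T).trans
        (add_le_add_right (Model.stateValue_le hR s) _))
  · rw [Strategy.averageCost_eq]
    refine le_limsup_div_of_mul_le hK fun T => ?_
    rcases T with _ | T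
    · simp
    · exact le_self_add.trans ((σ.le_sum_expectedCost hs hR hv T).trans
        (add_le_add_right (σ.expectedNextValue_le hR s T) _))

end Verification

end ProactiveCaching

end

theorem theorem1 (m : ProactiveCaching.Model) :
    ∃ (π : ProactiveCaching.Policy m) (T : ProactiveCaching.State → Fin m.B → ℝ),
      π.IsOptimal ∧
      ∀ s : ProactiveCaching.State, m.IsState s → 0 < s.elapsed →
        (∀ i, 0 ≤ T s i ∧ T s i ≤ m.Cmax) ∧
        (∀ i j, i ≤ j → T s j ≤ T s i) ∧
        ∀ c : ℝ, 0 < c → c ≤ m.Cmax →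
          π.act s c = ProactiveCaching.swaps m s {i | c ≤ T s i} := by
  obtain ⟨g, h, hs⟩ := m.exists_isSolution
  refine ⟨m.thresholdPolicy h, fun s i => m.threshold h s i,
    ProactiveCaching.isOptimal_thresholdPolicy hs, fun s hst he => ⟨fun i => ⟨le_max_left _ _,
      max_le m.Cmax_pos.le (min_le_left _ _)⟩,
      fun i j hij => ProactiveCaching.Model.threshold_anti hs s hij, fun c _ _ => ?_⟩⟩
  exact ProactiveCaching.Model.thresholdPolicy_act hst.valid he.ne' c
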